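/- Let $\gamma:(\mathbf R,t_0)\to\mathbf{R}P^3$ be a $C^\infty$ curve-germ. It is of *finite type* if, in each system of affine coordinates near $\gamma(t_0)$, the $3\times\infty$ matrix $(\gamma'(t_0),\gamma''(t_0),\dots)$ has rank $3$; its *type* is then $(a_1,a_2,a_3)$ with $a_i=\min\{r \mid \operatorname{rank}(\gamma'(t_0),\dots,\gamma^{(r)}(t_0))=i\}$. For a curve-germ of finite type the tangent line is defined at every parameter near $t_0$ (by continuity where $\gamma'=0$) and varies smoothly. The *tangent developable* of $\gamma$ is the germ at $(t_0,\gamma(t_0))$ of the map $(t,p)\mapsto p$ on the surface of pairs consisting of a parameter $t$ and a point $p$ of the tangent line at $t$. The *dual surface* of $\gamma$ is the germ, at $t_0$ and the osculating plane at $t_0$ (the plane spanned by $\gamma(t_0)$ and the directions $\gamma'(t_0),\dots,\gamma^{(a_2)}(t_0)$), of the map $(t,\Pi)\mapsto\Pi\in\mathbf{R}P^{3*}$ on the surface of pairs consisting of a parameter $t$ and a plane $\Pi$ containing the tangent line at $t$. Two surface-germs are *diffeomorphic* if they are $C^\infty$ right-left equivalent as map-germs $(\mathbf R^2,0)\to(\mathbf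 R^3,0)$, after a choice of local coordinates. The *cuspidal edge* and the *swallowtail* are the germs at $0$ of $(x,t)\mapsto(x,\,3t^2-2xt,\,2t^3-xt^2)$ and $(x,t)\mapsto(x,\,4t^3-2xt,\,3t^4-xt^2)$. (1) Let $\gamma,\gamma'$ be $C^\infty$ curve-germs of finite type in $\mathbf{R}P^3$. If their tangent developables are diffeomorphic, then their types coincide. (2) Let $\gamma$ be a $C^\infty$ curve-germ of finite type in $\mathbf{R}P^3$. If its dual surface is diffeomorphic to the cuspidal edge (resp. the swallowtail), then $\gamma$ has type $(1,2,3)$ (resp. $(1,2,4)$). -/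

import Mathlib

open scoped ContDiff Topology LinearAlgebra.Projectivization

noncomputable section

namespace TangentDev

/-- Homogeneous coordinate vectors. -/
abbrev V4 : Type := Fin 4 → ℝ

/-- Affine three-space. -/
abbrev E3 : Type := Fin 3 → ℝ

/-- Real projective three-space. The dual projective space is written in the dual homogeneous
coordinates, so a point `[Y]` of it is the plane `{[X] | X ⬝ᵥ Y = 0}`. -/
abbrev RP3 : Type := ℙ ℝ V4

/-- `p` is the point with homogeneous coordinates `x` (in particular `x ≠ 0`). -/
def HasCoords (p : RP3) (x : V4) : Prop :=
  ∃ h : x ≠ 0, p = Projectivization.mk ℝ x h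

/-- `f` is `C^∞` on a neighbourhood of `x`. (For the order `∞`, `ContDiffAt` at the single point
`x` would be weaker.) -/
def SmoothNear {E F : Type} [NormedAddCommGroup E] [NormedSpace ℝ E]
    [NormedAddCommGroup F] [NormedSpace ℝ F] (f : E → F) (x : E) : Prop :=
  ∀ᶠ y in 𝓝 x, ContDiffAt ℝ ∞ f y

/-! ### Affine coordinates -/

/-- `p` lies in the domain of the system of affine coordinates given by the linear change `A` of
homogeneous coordinates, i.e. off the plane at infinity. -/
def InChart (A : V4 ≃ₗ[ℝ] V4) (p : RP3) : Prop := A p.rep 0 ≠ 0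

/-- The system of affine coordinates of `A`: `[X] ↦ (x₁/x₀, x₂/x₀, x₃/x₀)` with `x = A X`. -/
def affCoord (A : V4 ≃ₗ[ℝ] V4) (p : RP3) : E3 := fun i => A p.rep i.succ / A p.rep 0

/-! ### Curve-germs, finite type, type -/

/-- `X` is a `C^∞` homogeneous lift of the germ of `γ` at `t₀`. -/
def IsLift (γ : ℝ → RP3) (t₀ : ℝ) (X : ℝ → V4) : Prop :=
  SmoothNear X t₀ ∧ ∀ᶠ t in 𝓝 t₀, HasCoords (γ t) (X t)

/-- The germ of `γ` at `t₀` is a `C^∞` curve-germ in projective space. -/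
def SmoothCurveGerm (γ : ℝ → RP3) (t₀ : ℝ) : Prop := ∃ X, IsLift γ t₀ X

/-- The `3 × r` matrix `(c'(t), c''(t), …, c⁽ʳ⁾(t))`. -/
def derivMatrix (c : ℝ → E3) (t : ℝ) (r : ℕ) : Matrix (Fin 3) (Fin r) ℝ :=
  Matrix.of fun i j => iteratedDeriv ((j : ℕ) + 1) c t i

/-- `γ` is of finite type at `t₀`: in each system of affine coordinates near `γ t₀`, the
`3 × ∞` matrix of all derivatives has rank `3`. -/
def FiniteType (γ : ℝ → RP3) (t₀ : ℝ) : Prop :=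
  ∀ A : V4 ≃ₗ[ℝ] V4, InChart A (γ t₀) →
    Module.finrank ℝ (Submodule.span ℝ
      (Set.range fun k : ℕ => iteratedDeriv (k + 1) (affCoord A ∘ γ) t₀)) = 3

/-- `γ` has type `(a₁, a₂, a₃)` at `t₀`: in each system of affine coordinates near `γ t₀`,
`aᵢ` is the least `r` such that the `3 × r` matrix of derivatives has rank `i`. -/
def HasType (γ : ℝ → RP3) (t₀ : ℝ) (a₁ a₂ a₃ : ℕ) : Prop :=
  ∀ A : V4 ≃ₗ[ℝ] V4, InChart A (γ t₀) →
    IsLeast {r | (derivMatrix (affCoord A ∘ γ) t₀ r).rank = 1} a₁ ∧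
    IsLeast {r | (derivMatrix (affCoord A ∘ γ) t₀ r).rank = 2} a₂ ∧
    IsLeast {r | (derivMatrix (affCoord A ∘ γ) t₀ r).rank = 3} a₃

/-! ### Tangent developables and dual surfaces -/

/-- `X` is a lift of `γ`, and for `t` near `t₀` the tangent line to `γ` at `t` is the projective
line of the plane spanned by `X t` and `W t`, which vary smoothly. At parameters where `γ` is
immersed this line is spanned by `X t` and `X' t`; for a curve of finite type these parameters are
dense near `t₀`, so the line at every parameter near `t₀` is determined by continuity. -/
def TangentFrame (γ : ℝ → RP3) (t₀ : ℝ) (X W : ℝ → V4) : Prop :=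
  IsLift γ t₀ X ∧ SmoothNear W t₀ ∧
    ∀ᶠ t in 𝓝 t₀, LinearIndependent ℝ ![X t, W t] ∧
      deriv X t ∈ Submodule.span ℝ {X t, W t}

/-- The germ of `F` at `(t₀, 0)` parametrises the tangent developable of the germ of `γ` at `t₀`,
the surface ruled by the tangent lines: `F (t, u)` runs over the tangent line at `t`, and
`F (t, 0) = γ t`. -/
def IsTangentDevelopable (γ : ℝ → RP3) (t₀ : ℝ) (F : ℝ × ℝ → RP3) : Prop :=
  ∃ X W : ℝ → V4, TangentFrame γ t₀ X W ∧
    ∀ᶠ z in 𝓝 (t₀, (0 : ℝ)), HasCoords (F z) (X z.1 + z.2 • W z.1)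

/-- The plane `[y]` is the osculating plane at `t₀` of the curve with lift `X`: the plane spanned
by `X t₀, X' t₀, …, X⁽ᵏ⁾ t₀` where these derivatives span a three-dimensional space. -/
def IsOsculatingPlane (X : ℝ → V4) (t₀ : ℝ) (y : V4) : Prop :=
  y ≠ 0 ∧ ∃ k : ℕ,
    Module.finrank ℝ (Submodule.span ℝ
      (Set.range fun j : Fin (k + 1) => iteratedDeriv (j : ℕ) X t₀)) = 3 ∧
    ∀ j ≤ k, iteratedDeriv j X t₀ ⬝ᵥ y = 0

/-- The germ of `F` at `(t₀, 0)` parametrises the dual surface of the germ of `γ` at `t₀`: the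
projection to the dual space of the conormal bundle of `γ`, i.e. of the set of pairs of a
parameter `t` and a plane that contains the tangent line at `t`. The planes at `t` form the pencil
`[Y t + u • Z t]`, and the base point is the osculating plane at `t₀`. -/
def IsDualSurface (γ : ℝ → RP3) (t₀ : ℝ) (F : ℝ × ℝ → RP3) : Prop :=
  ∃ X W Y Z : ℝ → V4, TangentFrame γ t₀ X W ∧ SmoothNear Y t₀ ∧ SmoothNear Z t₀ ∧
    (∀ᶠ t in 𝓝 t₀, LinearIndependent ℝ ![Y t, Z t] ∧
      X t ⬝ᵥ Y t = 0 ∧ W t ⬝ᵥ Y t = 0 ∧ X t ⬝ᵥ Z t = 0 ∧ W t ⬝ᵥ Z t = 0) ∧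
    IsOsculatingPlane X t₀ (Y t₀) ∧
    ∀ᶠ z in 𝓝 (t₀, (0 : ℝ)), HasCoords (F z) (Y z.1 + z.2 • Z z.1)

/-! ### Diffeomorphism of surface-germs (right-left equivalence) -/

/-- `φ` is a `C^∞` diffeomorphism between open sets. -/
def IsDiffeo {E : Type} [NormedAddCommGroup E] [NormedSpace ℝ E]
    (φ : OpenPartialHomeomorph E E) : Prop :=
  ContDiffOn ℝ ∞ φ φ.source ∧ ContDiffOn ℝ ∞ φ.symm φ.target

/-- The map-germs of `f` at `q` and of `g` at `q'` are `C^∞` right-left equivalent: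
`τ ∘ f = g ∘ σ` near `q` for diffeomorphism-germs `σ : (ℝ², q) → (ℝ², q')` and
`τ : (ℝ³, f q) → (ℝ³, g q')`. -/
def RightLeftEquiv (f : ℝ × ℝ → E3) (q : ℝ × ℝ) (g : ℝ × ℝ → E3) (q' : ℝ × ℝ) : Prop :=
  ∃ (σ : OpenPartialHomeomorph (ℝ × ℝ) (ℝ × ℝ)) (τ : OpenPartialHomeomorph E3 E3),
    IsDiffeo σ ∧ IsDiffeo τ ∧ q ∈ σ.source ∧ σ q = q' ∧ f q ∈ τ.source ∧
    ∀ᶠ z in 𝓝 q, τ (f z) = g (σ z)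

/-- Right-left equivalence of surface-germs in projective space, read in affine coordinates. -/
def DiffeoGerms (F : ℝ × ℝ → RP3) (q : ℝ × ℝ) (G : ℝ × ℝ → RP3) (q' : ℝ × ℝ) : Prop :=
  ∃ A B : V4 ≃ₗ[ℝ] V4, InChart A (F q) ∧ InChart B (G q') ∧
    RightLeftEquiv (affCoord A ∘ F) q (affCoord B ∘ G) q'

/-- The model cuspidal edge, in the parameters `z = (x, t)`. -/
def cuspidalEdge (z : ℝ × ℝ) : E3 :=
  ![z.1, 3 * z.2 ^ 2 - 2 * z.1 * z.2, 2 * z.2 ^ 3 - z.1 * z.2 ^ 2]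

/-- The model swallowtail, in the parameters `z = (x, t)`. -/
def swallowtail (z : ℝ × ℝ) : E3 :=
  ![z.1, 4 * z.2 ^ 3 - 2 * z.1 * z.2, 3 * z.2 ^ 4 - z.1 * z.2 ^ 2]

/-- The surface-germ of `F` at `q` in projective space is diffeomorphic to the germ at the origin
of `g`. -/
def DiffeoToModel (F : ℝ × ℝ → RP3) (q : ℝ × ℝ) (g : ℝ × ℝ → E3) : Prop :=
  ∃ A : V4 ≃ₗ[ℝ] V4, InChart A (F q) ∧ RightLeftEquiv (affCoord A ∘ F) q g (0, 0)

end TangentDev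

end

/-! A curve of finite type has affine coordinates `(c₁, c₂, c₃)` vanishing at `t₀` to the orders
given by its type. Then `h₂ = c₂'/c₁'`, `h₃ = c₃'/c₁'` and `k = h₃'/h₂'` extend smoothly to `t₀`.
With `a`, `b`, `d` the orders of `c₁'`, `h₂'`, `k'`, the type is `(a+1, a+b+2, a+b+d+3)`, so it
suffices to recover `a`, `b`, `d` from the developable `f(t,u) = c(t) + u T(t)`, where `T = (1, h₂,
h₃)`.

With `N = (0, 1, k)` one has `∂f/∂u = T` and `∂f/∂t = c₁' T + u h₂' N`. So `f` is immersed exactly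
where `u h₂' ≠ 0`, and its tangent plane there is the osculating plane, which depends on `t` alone.
Let `τ ∘ f = g ∘ σ` with `σ(t,u) = (s,v)`. For `b`: comparing Jacobians, `u h₂'(t)` equals `v
h₂'(s)` up to a unit; restricted to a diagonal line this compares `b` with `b'`. For `d`: by density
`dτ` carries osculating planes to osculating planes. Differentiating this along the kernel of `df`
on `u = 0` shows that `k'(t)` and `k'(s)` agree up to units. For `a`: if `σ` preserves the curve `u
= 0`, then `c₁'(t)` and `c₁'(s)` agree up to units. The only alternative is that `σ` sends `u = 0`
into the ruling over the base point, which forces `a = 0` and `d = d' = 0`. Running the argument in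
both directions gives equality (`DevCurve.orders_of_germEquiv`, `DevCurve.orders_unique`).

For (2), the dual surface is the developable of the curve of osculating planes, whose normal form
`DevCurve.dual` has the orders reversed to `(d, b, a)`. The two models are the developables of
explicit curves with orders `(0,0,0)` and `(1,0,0)`. -/

noncomputable section

namespace TangentDev

open Filter

/-! ### Functions smooth near a point -/

section Smooth

variable {E F G : Type} [NormedAddCommGroup E] [NormedSpace ℝ E] [NormedAddCommGroup F]
  [NormedSpace ℝ F] [NormedAddCommGroup G] [NormedSpace ℝ G]

theorem SmoothNear.contDiffAt {f : E → F} {x : E} (h : SmoothNear f x) : ContDiffAt ℝ ∞ f x :=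
  h.self_of_nhds

theorem SmoothNear.continuousAt {f : E → F} {x : E} (h : SmoothNear f x) : ContinuousAt f x :=
  h.contDiffAt.continuousAt

theorem SmoothNear.differentiableAt {f : E → F} {x : E} (h : SmoothNear f x) :
    DifferentiableAt ℝ f x :=
  h.contDiffAt.differentiableAt (by simp)

theorem SmoothNear.eventually {f : E → F} {x : E} (h : SmoothNear f x) :
    ∀ᶠ y in 𝓝 x, SmoothNear f y :=
  eventually_eventually_nhds.2 h

theorem SmoothNear.congr {f g : E → F} {x : E} (h : SmoothNear f x) (hfg : ∀ᶠ y in 𝓝 x, g y = f y) :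
    SmoothNear g x := by
  filter_upwards [h, eventually_eventually_nhds.2 hfg] with y hy hy'
  exact hy.congr_of_eventuallyEq hy'

theorem _root_.ContDiff.smoothNear {f : E → F} (h : ContDiff ℝ ∞ f) (x : E) : SmoothNear f x :=
  Eventually.of_forall fun _ => h.contDiffAt

theorem smoothNear_const (c : F) (x : E) : SmoothNear (fun _ : E => c) x :=
  contDiff_const.smoothNear x

theorem SmoothNear.comp {g : F → G} {f : E → F} {x : E} (hg : SmoothNear g (f x))
    (hf : SmoothNear f x) : SmoothNear (fun y => g (f y)) x := by
  filter_upwards [hf, hf.continuousAt.eventually hg] with y h1 h2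
  exact ContDiffAt.comp y h2 h1

theorem SmoothNear.comp_fst {f : ℝ → F} {p : ℝ × ℝ} (hf : SmoothNear f p.1) :
    SmoothNear (fun z : ℝ × ℝ => f z.1) p :=
  SmoothNear.comp (f := Prod.fst) hf (contDiff_fst.smoothNear p)

theorem smoothNear_fst (p : ℝ × ℝ) : SmoothNear (fun z : ℝ × ℝ => z.1) p :=
  contDiff_fst.smoothNear p

theorem smoothNear_snd (p : ℝ × ℝ) : SmoothNear (fun z : ℝ × ℝ => z.2) p :=
  contDiff_snd.smoothNear p

theorem SmoothNear.add {f g : E → F} {x : E} (hf : SmoothNear f x) (hg : SmoothNear g x) :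
    SmoothNear (fun y => f y + g y) x := by
  filter_upwards [hf, hg] with y h1 h2 using h1.add h2

theorem SmoothNear.sub {f g : E → F} {x : E} (hf : SmoothNear f x) (hg : SmoothNear g x) :
    SmoothNear (fun y => f y - g y) x := by
  filter_upwards [hf, hg] with y h1 h2 using h1.sub h2

theorem SmoothNear.neg {f : E → F} {x : E} (hf : SmoothNear f x) :
    SmoothNear (fun y => - f y) x := by
  filter_upwards [hf] with y h1 using h1.neg

theorem SmoothNear.mul {f g : E → ℝ} {x : E} (hf : SmoothNear f x) (hg : SmoothNear g x) :
    SmoothNear (fun y => f y * g y) x := by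
  filter_upwards [hf, hg] with y h1 h2 using h1.mul h2

theorem SmoothNear.div {f g : E → ℝ} {x : E} (hf : SmoothNear f x) (hg : SmoothNear g x)
    (h0 : g x ≠ 0) : SmoothNear (fun y => f y / g y) x := by
  filter_upwards [hf, hg, hg.continuousAt.eventually_ne h0] with y h1 h2 h3 using h1.div h2 h3

theorem SmoothNear.prodMk {f : E → F} {g : E → G} {x : E} (hf : SmoothNear f x)
    (hg : SmoothNear g x) : SmoothNear (fun y => (f y, g y)) x := by
  filter_upwards [hf, hg] with y h1 h2 using h1.prodMk h2

theorem smoothNear_pi {n : ℕ} {f : E → Fin n → ℝ} {x : E} (h : ∀ i, SmoothNear (fun y => f y i) x) :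
    SmoothNear f x := by
  filter_upwards [eventually_all.2 h] with y hy using contDiffAt_pi.2 hy

theorem SmoothNear.apply {n : ℕ} {f : E → Fin n → ℝ} {x : E} (h : SmoothNear f x) (i : Fin n) :
    SmoothNear (fun y => f y i) x := by
  filter_upwards [h] with y hy using contDiffAt_pi.1 hy i

theorem SmoothNear.linear [FiniteDimensional ℝ F] {f : E → F} {x : E} (h : SmoothNear f x)
    (L : F →ₗ[ℝ] G) : SmoothNear (fun y => L (f y)) x :=
  SmoothNear.comp (g := L) ((LinearMap.toContinuousLinearMap L).contDiff.smoothNear _) h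

theorem SmoothNear.fderiv {f : E → F} {x : E} (h : SmoothNear f x) :
    SmoothNear (fun y => fderiv ℝ f y) x := by
  filter_upwards [h] with y hy using hy.fderiv_right (by simp)

theorem SmoothNear.clm_apply {T : E → F →L[ℝ] G} {f : E → F} {x : E} (hT : SmoothNear T x)
    (hf : SmoothNear f x) : SmoothNear (fun y => T y (f y)) x := by
  filter_upwards [hT, hf] with y h1 h2 using h1.clm_apply h2

theorem SmoothNear.deriv {f : ℝ → F} {x : ℝ} (h : SmoothNear f x) : SmoothNear (deriv f) x :=
  (h.fderiv.clm_apply (smoothNear_const (1 : ℝ) x)).congr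
    (Eventually.of_forall fun y => by simp)

theorem smoothNear_sub_pow (t₀ x : ℝ) (k : ℕ) : SmoothNear (fun t : ℝ => (t - t₀) ^ k) x :=
  (contDiff_id.sub contDiff_const).pow k |>.smoothNear x

end Smooth

/-- Two continuous functions that agree off `t₀` near `t₀` agree near `t₀`. -/
theorem eventually_nhds_of_punctured {f g : ℝ → ℝ} {t₀ : ℝ} (hf : ContinuousAt f t₀)
    (hg : ContinuousAt g t₀) (h : ∀ᶠ t in 𝓝[≠] t₀, f t = g t) : ∀ᶠ t in 𝓝 t₀, f t = g t := by
  have h0 : f t₀ = g t₀ :=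
    tendsto_nhds_unique_of_eventuallyEq (hf.mono_left nhdsWithin_le_nhds)
      (hg.mono_left nhdsWithin_le_nhds) h
  rw [eventually_nhdsWithin_iff] at h
  filter_upwards [h] with t ht
  by_cases h1 : t = t₀
  · rw [h1, h0]
  · exact ht h1

/-! ### Smooth division -/

theorem hasDerivAt_integral_pow_mul {G : ℝ → ℝ} (hG : ContDiff ℝ ∞ G) (t₀ : ℝ) (m : ℕ) (t : ℝ) :
    HasDerivAt (fun t => ∫ s in (0 : ℝ)..1, s ^ m * G (t₀ + s * (t - t₀)))
      (∫ s in (0 : ℝ)..1, s ^ (m + 1) * deriv G (t₀ + s * (t - t₀))) t := by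
  have hG' : Continuous (deriv G) := hG.continuous_deriv (by simp)
  have hGc : Continuous G := hG.continuous
  have hcont : Continuous fun p : ℝ × ℝ => p.2 ^ (m + 1) * deriv G (t₀ + p.2 * (p.1 - t₀)) := by
    fun_prop
  obtain ⟨C, hC⟩ := ((isCompact_closedBall t 1).prod
    (isCompact_Icc (a := (0 : ℝ)) (b := 1))).exists_bound_of_continuousOn hcont.continuousOn
  refine (intervalIntegral.hasDerivAt_integral_of_dominated_loc_of_deriv_le
    (μ := MeasureTheory.volume)
    (F := fun t s => s ^ m * G (t₀ + s * (t - t₀)))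
    (F' := fun t s => s ^ (m + 1) * deriv G (t₀ + s * (t - t₀))) (bound := fun _ => C)
    (Metric.closedBall_mem_nhds t one_pos) ?_ ?_ ?_ ?_ ?_ ?_).2
  · exact Eventually.of_forall fun x => Continuous.aestronglyMeasurable (by fun_prop)
  · exact Continuous.intervalIntegrable (by fun_prop) _ _
  · exact Continuous.aestronglyMeasurable (by fun_prop)
  · refine Eventually.of_forall fun s hs x hx => ?_
    rw [Set.uIoc_of_le zero_le_one] at hs
    exact hC (x, s) ⟨hx, hs.1.le, hs.2⟩
  · exact intervalIntegrable_const
  · refine Eventually.of_forall fun s _ x _ => ?_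
    have h1 : HasDerivAt (fun t : ℝ => t₀ + s * (t - t₀)) s x := by
      simpa using (((hasDerivAt_id x).sub_const t₀).const_mul s).const_add t₀
    have h2 := ((hG.differentiable (by simp)).differentiableAt (x := t₀ + s * (x - t₀))).hasDerivAt
    have h3 := (h2.comp x h1).const_mul (s ^ m)
    refine h3.congr_deriv ?_
    ring

/-- Differentiation under the integral replaces `(G, m)` by `(G', m + 1)`, so the induction on the
order of smoothness runs over all `G` and `m` at once. -/
theorem contDiff_integral_pow_mul {G : ℝ → ℝ} (hG : ContDiff ℝ ∞ G) (t₀ : ℝ) (m : ℕ) :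
    ContDiff ℝ ∞ (fun t => ∫ s in (0 : ℝ)..1, s ^ m * G (t₀ + s * (t - t₀))) := by
  rw [contDiff_infty]
  intro n
  induction n generalizing G m with
  | zero =>
    have : Differentiable ℝ (fun t => ∫ s in (0 : ℝ)..1, s ^ m * G (t₀ + s * (t - t₀))) :=
      fun t => (hasDerivAt_integral_pow_mul hG t₀ m t).differentiableAt
    exact contDiff_zero.2 this.continuous
  | succ n ih =>
    push_cast
    rw [contDiff_succ_iff_deriv]
    refine ⟨fun t => (hasDerivAt_integral_pow_mul hG t₀ m t).differentiableAt, by simp, ?_⟩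
    have : deriv (fun t => ∫ s in (0 : ℝ)..1, s ^ m * G (t₀ + s * (t - t₀))) = fun t =>
        ∫ s in (0 : ℝ)..1, s ^ (m + 1) * deriv G (t₀ + s * (t - t₀)) :=
      funext fun t => (hasDerivAt_integral_pow_mul hG t₀ m t).deriv
    rw [this]
    exact ih (contDiff_infty_iff_deriv.1 hG).2 (m + 1)

/-- Multiplication by a bump function makes a germ global, so that parametric integrals of it are
smooth everywhere. -/
theorem SmoothNear.exists_contDiff {f : ℝ → ℝ} {t₀ : ℝ} (hf : SmoothNear f t₀) :
    ∃ G : ℝ → ℝ, ContDiff ℝ ∞ G ∧ ∀ᶠ t in 𝓝 t₀, f t = G t := by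
  obtain ⟨r, hr, hball⟩ := Metric.eventually_nhds_iff_ball.1 hf
  let φ : ContDiffBump t₀ := ⟨r / 3, r / 2, by positivity, by linarith⟩
  refine ⟨fun t => φ t * f t, ?_, ?_⟩
  · refine contDiff_iff_contDiffAt.2 fun t => ?_
    by_cases ht : t ∈ tsupport φ
    · refine φ.contDiffAt.mul (hball t ?_)
      rw [φ.tsupport_eq] at ht
      exact Metric.closedBall_subset_ball (show r / 2 < r by linarith) ht
    · have h0 : ∀ᶠ x in 𝓝 t, φ x * f x = 0 := by
        filter_upwards [(isClosed_tsupport φ).isOpen_compl.mem_nhds ht] with x hx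
        rw [image_eq_zero_of_notMem_tsupport hx, zero_mul]
      exact (contDiffAt_const (c := (0 : ℝ))).congr_of_eventuallyEq h0
  · filter_upwards [φ.eventuallyEq_one] with t ht
    rw [ht]; simp

/-! ### Orders of vanishing -/

/-- `f` vanishes at `t₀` to the exact order `k`. -/
def HasOrder (f : ℝ → ℝ) (t₀ : ℝ) (k : ℕ) : Prop :=
  ∃ h : ℝ → ℝ, SmoothNear h t₀ ∧ h t₀ ≠ 0 ∧ ∀ᶠ t in 𝓝 t₀, f t = (t - t₀) ^ k * h t

namespace HasOrder

variable {f g : ℝ → ℝ} {t₀ : ℝ} {k l : ℕ}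

theorem smoothNear (hf : HasOrder f t₀ k) : SmoothNear f t₀ := by
  obtain ⟨h, hs, -, he⟩ := hf
  exact ((smoothNear_sub_pow t₀ t₀ k).mul hs).congr he

theorem congr (hf : HasOrder f t₀ k) (hfg : ∀ᶠ t in 𝓝 t₀, g t = f t) : HasOrder g t₀ k := by
  obtain ⟨h, hs, h0, he⟩ := hf
  exact ⟨h, hs, h0, by filter_upwards [he, hfg] with t h1 h2; rw [h2, h1]⟩

theorem ne_zero (hf : HasOrder f t₀ k) : ∀ᶠ t in 𝓝[≠] t₀, f t ≠ 0 := by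
  obtain ⟨h, hs, h0, he⟩ := hf
  filter_upwards [nhdsWithin_le_nhds (he.and (hs.continuousAt.eventually_ne h0)),
    self_mem_nhdsWithin] with t h1 h2
  rw [h1.1]
  exact mul_ne_zero (pow_ne_zero _ (sub_ne_zero.2 h2)) h1.2

theorem apply_eq_zero (hf : HasOrder f t₀ k) (hk : k ≠ 0) : f t₀ = 0 := by
  obtain ⟨h, -, -, he⟩ := hf
  rw [he.self_of_nhds, sub_self, zero_pow hk, zero_mul]

theorem apply_ne_zero (hf : HasOrder f t₀ 0) : f t₀ ≠ 0 := by
  obtain ⟨h, -, h0, he⟩ := hf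
  rw [he.self_of_nhds]; simpa using h0

theorem of_apply_ne_zero (hf : SmoothNear f t₀) (h0 : f t₀ ≠ 0) : HasOrder f t₀ 0 :=
  ⟨f, hf, h0, by simp⟩

theorem eq_zero_of_apply_ne_zero (hf : HasOrder f t₀ k) (h0 : f t₀ ≠ 0) : k = 0 :=
  by_contra fun hk => h0 (hf.apply_eq_zero hk)

theorem mul (hf : HasOrder f t₀ k) (hg : HasOrder g t₀ l) :
    HasOrder (fun t => f t * g t) t₀ (k + l) := by
  obtain ⟨p, hs, h0, he⟩ := hf
  obtain ⟨q, hs', h0', he'⟩ := hg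
  refine ⟨fun t => p t * q t, hs.mul hs', mul_ne_zero h0 h0', ?_⟩
  filter_upwards [he, he'] with t h1 h2
  rw [h1, h2]; ring

theorem neg (hf : HasOrder f t₀ k) : HasOrder (fun t => - f t) t₀ k := by
  obtain ⟨p, hs, h0, he⟩ := hf
  refine ⟨fun t => - p t, hs.neg, neg_ne_zero.2 h0, ?_⟩
  filter_upwards [he] with t h1
  rw [h1]; ring

theorem exists_quotient (hf : HasOrder f t₀ (k + l)) (hg : HasOrder g t₀ k) :
    ∃ q, HasOrder q t₀ l ∧ ∀ᶠ t in 𝓝 t₀, f t = q t * g t := by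
  obtain ⟨p, hs, h0, he⟩ := hf
  obtain ⟨r, hs', h0', he'⟩ := hg
  refine ⟨fun t => (t - t₀) ^ l * (p t / r t), ⟨_, hs.div hs' h0', div_ne_zero h0 h0', by simp⟩, ?_⟩
  filter_upwards [he, he', hs'.continuousAt.eventually_ne h0'] with t h1 h2 h3
  rw [h1, h2]; field_simp; ring

theorem deriv (hf : HasOrder f t₀ (k + 1)) : HasOrder (deriv f) t₀ k := by
  obtain ⟨p, hs, h0, he⟩ := hf
  refine ⟨fun t => (k + 1) * p t + (t - t₀) * _root_.deriv p t,
    ((smoothNear_const _ _).mul hs).add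
      (((contDiff_id.sub contDiff_const).smoothNear t₀).mul hs.deriv), ?_, ?_⟩
  · simp only [sub_self, zero_mul, add_zero]
    exact mul_ne_zero (by positivity) h0
  · filter_upwards [eventually_eventually_nhds.2 he, hs.eventually] with t h1 h2
    have h3 : HasDerivAt (fun t : ℝ => (t - t₀) ^ (k + 1)) ((k + 1) * (t - t₀) ^ k) t := by
      refine (((hasDerivAt_id t).sub_const t₀).fun_pow (k + 1)).congr_deriv ?_
      simp
    rw [EventuallyEq.deriv_eq h1, (h3.fun_mul h2.differentiableAt.hasDerivAt).deriv]
    ring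

/-- Hadamard's lemma: if `f' = (t - t₀)^k p`, substituting `x = t₀ + s (t - t₀)` in `∫ f'` gives `f
= (t - t₀)^(k+1) ∫₀¹ s^k p(t₀ + s (t - t₀)) ds`, and the integral equals `p(t₀)/(k+1)` at `t₀`. -/
theorem of_deriv (hs : SmoothNear f t₀) (h0 : f t₀ = 0) (hf : HasOrder (_root_.deriv f) t₀ k) :
    HasOrder f t₀ (k + 1) := by
  obtain ⟨p, hp, hp0, he⟩ := hf
  obtain ⟨G, hG, hpG⟩ := hp.exists_contDiff
  have hGc := hG.continuous
  refine ⟨fun t => ∫ s in (0 : ℝ)..1, s ^ k * G (t₀ + s * (t - t₀)),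
    (contDiff_integral_pow_mul hG t₀ k).smoothNear t₀, ?_, ?_⟩
  · simp only [sub_self, mul_zero, add_zero, intervalIntegral.integral_mul_const, integral_pow]
    rw [← hpG.self_of_nhds]
    refine mul_ne_zero ?_ hp0
    simp
    positivity
  · obtain ⟨r, hr, hball⟩ := Metric.eventually_nhds_iff_ball.1 (he.and (hpG.and hs))
    filter_upwards [Metric.ball_mem_nhds t₀ hr] with t ht
    have hsub : Set.uIcc t₀ t ⊆ Metric.ball t₀ r :=
      (convex_ball t₀ r).ordConnected.uIcc_subset (Metric.mem_ball_self hr) ht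
    have h1 : ∫ x in t₀..t, (x - t₀) ^ k * G x = f t - f t₀ := by
      refine intervalIntegral.integral_eq_sub_of_hasDerivAt (fun x hx => ?_)
        (Continuous.intervalIntegrable (by fun_prop) _ _)
      obtain ⟨e1, e2, e3⟩ := hball x (hsub hx)
      rw [← e2, ← e1]
      have e4 : DifferentiableAt ℝ f x := ContDiffAt.differentiableAt (n := ∞) e3 (by simp)
      exact e4.hasDerivAt
    have h2 := intervalIntegral.smul_integral_comp_mul_add (a := 0) (b := 1)
      (fun x => (x - t₀) ^ k * G x) (t - t₀) t₀
    simp only [mul_zero, zero_add, mul_one, sub_add_cancel, add_sub_cancel_right] at h2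
    rw [h1, h0, sub_zero] at h2
    have h3 : ∫ x in (0 : ℝ)..1, ((t - t₀) * x) ^ k * G ((t - t₀) * x + t₀) =
        ∫ s in (0 : ℝ)..1, (t - t₀) ^ k * (s ^ k * G (t₀ + s * (t - t₀))) := by
      refine intervalIntegral.integral_congr fun s _ => ?_
      simp only [mul_pow]
      rw [show (t - t₀) * s + t₀ = t₀ + s * (t - t₀) by ring]
      ring
    rw [← h2, h3, intervalIntegral.integral_const_mul, smul_eq_mul]
    ring

theorem iteratedDeriv_eq_zero {j : ℕ} (hf : HasOrder f t₀ k) (hj : j < k) :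
    iteratedDeriv j f t₀ = 0 := by
  induction k generalizing f j with
  | zero => omega
  | succ k ih =>
    cases j with
    | zero => simpa using hf.apply_eq_zero (by simp)
    | succ j => rw [iteratedDeriv_succ']; exact ih hf.deriv (by omega)

theorem iteratedDeriv_ne_zero (hf : HasOrder f t₀ k) : iteratedDeriv k f t₀ ≠ 0 := by
  induction k generalizing f with
  | zero => simpa using hf.apply_ne_zero
  | succ k ih => rw [iteratedDeriv_succ']; exact ih hf.deriv

theorem of_iteratedDeriv (hs : SmoothNear f t₀) (h0 : ∀ j < k, iteratedDeriv j f t₀ = 0)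
    (hk : iteratedDeriv k f t₀ ≠ 0) : HasOrder f t₀ k := by
  induction k generalizing f with
  | zero => exact of_apply_ne_zero hs (by simpa using hk)
  | succ k ih =>
    refine of_deriv hs (by simpa using h0 0 (by simp)) (ih hs.deriv (fun j hj => ?_) ?_)
    · rw [← iteratedDeriv_succ']; exact h0 _ (by omega)
    · rwa [← iteratedDeriv_succ']

end HasOrder

/-- If `k < l`, division by `(t - t₀)^k` would force `A → 0`. The limit `b` may be zero, which is
what a one-sided comparison needs. -/
theorem pow_exponent_le {t₀ a b : ℝ} {A B : ℝ → ℝ} {k l : ℕ} (hA : Tendsto A (𝓝[≠] t₀) (𝓝 a))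
    (ha : a ≠ 0) (hB : Tendsto B (𝓝[≠] t₀) (𝓝 b))
    (h : ∀ᶠ t in 𝓝[≠] t₀, (t - t₀) ^ k * A t = (t - t₀) ^ l * B t) : l ≤ k := by
  by_contra! hlt
  obtain ⟨m, rfl⟩ := Nat.exists_eq_add_of_lt hlt
  have h1 : ∀ᶠ t in 𝓝[≠] t₀, A t = (t - t₀) ^ (m + 1) * B t := by
    filter_upwards [h, self_mem_nhdsWithin] with t ht hne
    refine mul_left_cancel₀ (pow_ne_zero k (sub_ne_zero.2 hne)) ?_
    rw [ht]; ring
  have h2 : Tendsto (fun t => (t - t₀) ^ (m + 1) * B t) (𝓝[≠] t₀) (𝓝 (0 * b)) := by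
    refine Tendsto.mul ?_ hB
    have := (smoothNear_sub_pow t₀ t₀ (m + 1)).continuousAt.tendsto
    simp only [sub_self, ne_eq, Nat.add_eq_zero_iff, one_ne_zero, and_false, not_false_eq_true,
      zero_pow] at this
    exact this.mono_left nhdsWithin_le_nhds
  rw [zero_mul] at h2
  exact ha (tendsto_nhds_unique_of_eventuallyEq hA h2 h1)

theorem exists_slope {φ : ℝ → ℝ} {t₀ φ' : ℝ} (h : HasDerivAt φ φ' t₀) :
    ∃ r : ℝ → ℝ, Tendsto r (𝓝[≠] t₀) (𝓝 φ') ∧ ∀ t, φ t - φ t₀ = (t - t₀) * r t :=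
  ⟨slope φ t₀, hasDerivAt_iff_tendsto_slope.1 h, fun t => by
    rw [← smul_eq_mul, sub_smul_slope, vsub_eq_sub]⟩

/-- Orders of vanishing are invariant under reparametrisation and multiplication by units. -/
theorem HasOrder.eq_of_comp {f g A B s : ℝ → ℝ} {t₀ s' : ℝ} {k l : ℕ} (hf : HasOrder f t₀ k)
    (hs : HasDerivAt s s' t₀) (hs' : s' ≠ 0) (hg : HasOrder g (s t₀) l)
    (hA : ContinuousAt A t₀) (hA0 : A t₀ ≠ 0) (hB : ContinuousAt B t₀) (hB0 : B t₀ ≠ 0)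
    (h : ∀ᶠ t in 𝓝 t₀, f t * A t = g (s t) * B t) : k = l := by
  obtain ⟨p, hp, hp0, hfp⟩ := hf
  obtain ⟨q, hq, hq0, hgq⟩ := hg
  obtain ⟨r, hr, hsr⟩ := exists_slope hs
  have hA1 : Tendsto (fun t => p t * A t) (𝓝[≠] t₀) (𝓝 (p t₀ * A t₀)) :=
    (hp.continuousAt.mul hA).mono_left nhdsWithin_le_nhds
  have hB1 : Tendsto (fun t => r t ^ l * (q (s t) * B t)) (𝓝[≠] t₀)
      (𝓝 (s' ^ l * (q (s t₀) * B t₀))) := by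
    refine (hr.pow l).mul (((ContinuousAt.comp (f := s) hq.continuousAt hs.continuousAt).mul
      hB).mono_left nhdsWithin_le_nhds)
  have he : ∀ᶠ t in 𝓝[≠] t₀,
      (t - t₀) ^ k * (p t * A t) = (t - t₀) ^ l * (r t ^ l * (q (s t) * B t)) := by
    filter_upwards [nhdsWithin_le_nhds (h.and (hfp.and (hs.continuousAt.eventually hgq)))]
      with t ht
    obtain ⟨h1, h2, h3⟩ := ht
    rw [h2, h3, hsr, mul_pow] at h1
    linear_combination h1
  exact le_antisymm
    (pow_exponent_le hB1 (mul_ne_zero (pow_ne_zero _ hs') (mul_ne_zero hq0 hB0)) hA1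
      (he.mono fun _ h => h.symm))
    (pow_exponent_le hA1 (mul_ne_zero hp0 hA0) hB1 he)

/-! ### Germs of diffeomorphisms and right-left equivalence -/

section Germs

variable {E : Type} [NormedAddCommGroup E] [NormedSpace ℝ E]

/-- `φ : (E, p) → (E, q)` is a diffeomorphism-germ with inverse germ `ψ`. -/
structure DiffeoGerm (φ ψ : E → E) (p q : E) : Prop where
  smooth : SmoothNear φ p
  smooth_inv : SmoothNear ψ q
  map_base : φ p = q
  inv_base : ψ q = p
  left_inv : ∀ᶠ x in 𝓝 p, ψ (φ x) = x
  right_inv : ∀ᶠ y in 𝓝 q, φ (ψ y) = y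

namespace DiffeoGerm

variable {φ ψ φ' ψ' : E → E} {p q r : E}

theorem symm (h : DiffeoGerm φ ψ p q) : DiffeoGerm ψ φ q p :=
  ⟨h.smooth_inv, h.smooth, h.inv_base, h.map_base, h.right_inv, h.left_inv⟩

theorem tendsto (h : DiffeoGerm φ ψ p q) : Tendsto φ (𝓝 p) (𝓝 q) := by
  have := h.smooth.continuousAt.tendsto
  rwa [h.map_base] at this

theorem trans (h : DiffeoGerm φ ψ p q) (h' : DiffeoGerm φ' ψ' q r) :
    DiffeoGerm (fun x => φ' (φ x)) (fun y => ψ (ψ' y)) p r where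
  smooth := SmoothNear.comp (by rw [h.map_base]; exact h'.smooth) h.smooth
  smooth_inv := SmoothNear.comp (by rw [h'.inv_base]; exact h.smooth_inv) h'.smooth_inv
  map_base := by rw [h.map_base, h'.map_base]
  inv_base := by rw [h'.inv_base, h.inv_base]
  left_inv := by
    filter_upwards [h.left_inv, h.tendsto.eventually h'.left_inv] with x h1 h2
    rw [h2, h1]
  right_inv := by
    filter_upwards [h'.right_inv, h'.symm.tendsto.eventually h.right_inv] with x h1 h2
    rw [h2, h1]

theorem fderiv_inv_fderiv (h : DiffeoGerm φ ψ p q) (x : E) :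
    fderiv ℝ ψ q (fderiv ℝ φ p x) = x := by
  have h1 : HasFDerivAt φ (fderiv ℝ φ p) p := h.smooth.differentiableAt.hasFDerivAt
  have h2 : HasFDerivAt ψ (fderiv ℝ ψ q) (φ p) := by
    rw [h.map_base]; exact h.smooth_inv.differentiableAt.hasFDerivAt
  have h3 : HasFDerivAt (fun x => x) ((fderiv ℝ ψ q).comp (fderiv ℝ φ p)) p :=
    (h2.comp p h1).congr_of_eventuallyEq (h.left_inv.mono fun x hx => hx.symm)
  have := h3.unique (hasFDerivAt_id p)
  exact congrArg (fun L : E →L[ℝ] E => L x) this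

theorem fderiv_eq_zero (h : DiffeoGerm φ ψ p q) {x : E} (hx : fderiv ℝ φ p x = 0) : x = 0 := by
  rw [← h.fderiv_inv_fderiv x, hx, map_zero]

theorem of_openPartialHomeomorph {φ : OpenPartialHomeomorph E E} (hφ : IsDiffeo φ)
    (hp : p ∈ φ.source) : DiffeoGerm φ φ.symm p (φ p) where
  smooth := by
    filter_upwards [φ.open_source.mem_nhds hp] with y hy
    exact hφ.1.contDiffAt (φ.open_source.mem_nhds hy)
  smooth_inv := by
    filter_upwards [φ.open_target.mem_nhds (φ.map_source hp)] with y hy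
    exact hφ.2.contDiffAt (φ.open_target.mem_nhds hy)
  map_base := rfl
  inv_base := φ.left_inv hp
  left_inv := φ.eventually_left_inverse hp
  right_inv := φ.eventually_right_inverse (φ.map_source hp)

end DiffeoGerm

/-- Right-left equivalence of germs of maps, expressed by germs of diffeomorphisms. -/
def GermEquiv (f : ℝ × ℝ → E3) (p : ℝ × ℝ) (g : ℝ × ℝ → E3) (q : ℝ × ℝ) : Prop :=
  ∃ σ σ' τ τ', DiffeoGerm σ σ' p q ∧ DiffeoGerm τ τ' (f p) (g q) ∧
    ∀ᶠ z in 𝓝 p, τ (f z) = g (σ z)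

variable {f g k : ℝ × ℝ → E3} {p q r : ℝ × ℝ}

theorem RightLeftEquiv.germEquiv (h : RightLeftEquiv f p g q) : GermEquiv f p g q := by
  obtain ⟨σ, τ, hσ, hτ, hp, rfl, hfp, he⟩ := h
  refine ⟨σ, σ.symm, τ, τ.symm, .of_openPartialHomeomorph hσ hp, ?_, he⟩
  rw [← he.self_of_nhds]
  exact .of_openPartialHomeomorph hτ hfp

theorem GermEquiv.symm (h : GermEquiv f p g q) (hf : ContinuousAt f p) : GermEquiv g q f p := by
  obtain ⟨σ, σ', τ, τ', hσ, hτ, he⟩ := h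
  refine ⟨σ', σ, τ', τ, hσ.symm, hτ.symm, ?_⟩
  filter_upwards [hσ.right_inv, hσ.symm.tendsto.eventually he,
    hσ.symm.tendsto.eventually (hf.eventually hτ.left_inv)] with w h1 h2 h3
  rw [h1] at h2
  rw [← h2, h3]

theorem GermEquiv.trans (h : GermEquiv f p g q) (h' : GermEquiv g q k r) : GermEquiv f p k r := by
  obtain ⟨σ, σ', τ, τ', hσ, hτ, he⟩ := h
  obtain ⟨σ₁, σ₁', τ₁, τ₁', hσ₁, hτ₁, he₁⟩ := h'
  refine ⟨_, _, _, _, hσ.trans hσ₁, hτ.trans hτ₁, ?_⟩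
  filter_upwards [he, hσ.tendsto.eventually he₁] with z h1 h2
  rw [h1, h2]

end Germs

/-! ### Developables in normal form -/

/-- A curve `(c₁, c₂, c₃)` near `t₀` whose tangent direction `(1, h₂, h₃)` and second osculating
direction `(0, 1, k)` extend smoothly to `t₀`. -/
structure DevCurve (t₀ : ℝ) where
  (c₁ c₂ c₃ h₂ h₃ k : ℝ → ℝ)
  smooth_c₁ : SmoothNear c₁ t₀
  smooth_c₂ : SmoothNear c₂ t₀
  smooth_c₃ : SmoothNear c₃ t₀
  smooth_h₂ : SmoothNear h₂ t₀
  smooth_h₃ : SmoothNear h₃ t₀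
  smooth_k : SmoothNear k t₀
  deriv_c₂ : ∀ᶠ t in 𝓝 t₀, deriv c₂ t = h₂ t * deriv c₁ t
  deriv_c₃ : ∀ᶠ t in 𝓝 t₀, deriv c₃ t = h₃ t * deriv c₁ t
  deriv_h₃ : ∀ᶠ t in 𝓝 t₀, deriv h₃ t = k t * deriv h₂ t

namespace DevCurve

variable {t₀ : ℝ}

/-- The orders of vanishing that determine the type of the curve. -/
structure HasOrders (D : DevCurve t₀) (a b d : ℕ) : Prop where
  order_c₁ : HasOrder (deriv D.c₁) t₀ a
  order_h₂ : HasOrder (deriv D.h₂) t₀ b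
  order_k : HasOrder (deriv D.k) t₀ d

/-- The tangent developable of the curve. -/
def surface (D : DevCurve t₀) (z : ℝ × ℝ) : E3 :=
  ![D.c₁ z.1 + z.2, D.c₂ z.1 + z.2 * D.h₂ z.1, D.c₃ z.1 + z.2 * D.h₃ z.1]

/-- The tangent direction. -/
def tangent (D : DevCurve t₀) (t : ℝ) : E3 := ![1, D.h₂ t, D.h₃ t]

/-- A direction that spans the osculating plane together with the tangent direction. -/
def second (D : DevCurve t₀) (t : ℝ) : E3 := ![0, 1, D.k t]

theorem smoothNear_tangent (D : DevCurve t₀) : SmoothNear D.tangent t₀ :=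
  smoothNear_pi fun i => by
    fin_cases i
    · exact smoothNear_const _ _
    · exact D.smooth_h₂
    · exact D.smooth_h₃

theorem smoothNear_second (D : DevCurve t₀) : SmoothNear D.second t₀ :=
  smoothNear_pi fun i => by
    fin_cases i
    · exact smoothNear_const _ _
    · exact smoothNear_const _ _
    · exact D.smooth_k

theorem smoothNear_surface (D : DevCurve t₀) : SmoothNear D.surface (t₀, 0) :=
  smoothNear_pi fun i => by
    fin_cases i
    · exact (SmoothNear.comp_fst (p := (t₀, 0)) D.smooth_c₁).add (smoothNear_snd _)
    · exact (SmoothNear.comp_fst (p := (t₀, 0)) D.smooth_c₂).add ((smoothNear_snd _).mul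
        (SmoothNear.comp_fst (p := (t₀, 0)) D.smooth_h₂))
    · exact (SmoothNear.comp_fst (p := (t₀, 0)) D.smooth_c₃).add ((smoothNear_snd _).mul
        (SmoothNear.comp_fst (p := (t₀, 0)) D.smooth_h₃))

theorem hasFDerivAt_ruled {c h : ℝ → ℝ} {z : ℝ × ℝ} (hc : DifferentiableAt ℝ c z.1)
    (hh : DifferentiableAt ℝ h z.1) :
    HasFDerivAt (fun z : ℝ × ℝ => c z.1 + z.2 * h z.1)
      ((deriv c z.1 + z.2 * deriv h z.1) • ContinuousLinearMap.fst ℝ ℝ ℝ +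
        h z.1 • ContinuousLinearMap.snd ℝ ℝ ℝ) z := by
  have h1 := hc.hasDerivAt.comp_hasFDerivAt z (hasFDerivAt_fst (𝕜 := ℝ) (p := z))
  have h2 := hh.hasDerivAt.comp_hasFDerivAt z (hasFDerivAt_fst (𝕜 := ℝ) (p := z))
  refine (h1.add ((hasFDerivAt_snd (𝕜 := ℝ) (p := z)).mul h2)).congr_fderiv ?_
  ext <;> simp

/-- The formula comes from `c' = c₁' T` and `T' = h₂' N`. The rank drops exactly where `u h₂' = 0`,
and on `u = 0` the vector `(1, -c₁')` is in the kernel. -/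
theorem fderiv_surface (D : DevCurve t₀) : ∀ᶠ z in 𝓝 (t₀, (0 : ℝ)), ∀ x y : ℝ,
    fderiv ℝ D.surface z (x, y) = x • (deriv D.c₁ z.1 • D.tangent z.1 +
      (z.2 * deriv D.h₂ z.1) • D.second z.1) + y • D.tangent z.1 := by
  have hfst : Tendsto (Prod.fst : ℝ × ℝ → ℝ) (𝓝 (t₀, (0 : ℝ))) (𝓝 t₀) := continuousAt_fst
  filter_upwards [hfst.eventually D.smooth_c₁.eventually, hfst.eventually D.smooth_c₂.eventually,
    hfst.eventually D.smooth_c₃.eventually, hfst.eventually D.smooth_h₂.eventually,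
    hfst.eventually D.smooth_h₃.eventually, hfst.eventually D.deriv_c₂,
    hfst.eventually D.deriv_c₃, hfst.eventually D.deriv_h₃, D.smoothNear_surface.eventually]
    with z h1 h2 h3 h4 h5 e2 e3 e4 hs x y
  have key : ∀ i, HasFDerivAt (fun z => D.surface z i)
      ((ContinuousLinearMap.proj i).comp (fderiv ℝ D.surface z)) z := fun i =>
    hasFDerivAt_pi'.1 hs.differentiableAt.hasFDerivAt i
  have k0 := (key 0).unique ((hasFDerivAt_ruled (c := D.c₁) (h := fun _ => 1) h1.differentiableAt
    (differentiableAt_const _)).congr_of_eventuallyEq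
      (Eventually.of_forall fun z => by simp [surface]))
  have k1 := (key 1).unique (hasFDerivAt_ruled h2.differentiableAt h4.differentiableAt)
  have k2 := (key 2).unique (hasFDerivAt_ruled h3.differentiableAt h5.differentiableAt)
  have k0' := congrArg (fun L : ℝ × ℝ →L[ℝ] ℝ => L (x, y)) k0
  have k1' := congrArg (fun L : ℝ × ℝ →L[ℝ] ℝ => L (x, y)) k1
  have k2' := congrArg (fun L : ℝ × ℝ →L[ℝ] ℝ => L (x, y)) k2
  simp at k0' k1' k2'
  rw [e2] at k1'
  rw [e3, e4] at k2'
  ext i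
  fin_cases i
  · simp [k0', tangent, second]; ring
  · simp [k1', tangent, second]; ring
  · simp [k2', tangent, second]; ring

end DevCurve

/-- A germ of a continuous function that vanishes off the lines `t = t₀` and `u = 0` vanishes. -/
theorem eventually_eq_zero_of_off_axes {φ : ℝ × ℝ → ℝ} {t₀ : ℝ} (hφ : SmoothNear φ (t₀, 0))
    (h : ∀ᶠ z in 𝓝 (t₀, (0 : ℝ)), z.1 ≠ t₀ → z.2 ≠ 0 → φ z = 0) :
    ∀ᶠ z in 𝓝 (t₀, (0 : ℝ)), φ z = 0 := by
  have hd : Dense (({t₀}ᶜ : Set ℝ) ×ˢ ({0}ᶜ : Set ℝ)) :=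
    (dense_compl_singleton t₀).prod (dense_compl_singleton 0)
  filter_upwards [hφ.eventually, eventually_eventually_nhds.2 h] with z h1 h2
  have h3 : ∃ᶠ w in 𝓝 z, w ∈ (({t₀}ᶜ : Set ℝ) ×ˢ ({0}ᶜ : Set ℝ)) :=
    mem_closure_iff_frequently.1 (hd z)
  have h4 : ∃ᶠ w in 𝓝 z, φ w ∈ ({0} : Set ℝ) :=
    (h3.and_eventually h2).mono fun w hw => hw.2 hw.1.1 hw.1.2
  exact isClosed_singleton.mem_of_frequently_of_tendsto h4 h1.continuousAt

theorem hasDerivAt_along_line {F : Type} [NormedAddCommGroup F] [NormedSpace ℝ F]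
    {f : ℝ × ℝ → F} {t u : ℝ} (hf : DifferentiableAt ℝ f (t, u)) (y : ℝ) :
    HasDerivAt (fun l : ℝ => f (t + l, u + l * y)) (fderiv ℝ f (t, u) (1, y)) 0 := by
  have h1 : HasDerivAt (fun l : ℝ => (t + l, u + l * y)) (1, y) 0 := by
    refine HasDerivAt.prodMk ?_ ?_
    · simpa using (hasDerivAt_id (0 : ℝ)).const_add t
    · simpa using ((hasDerivAt_id (0 : ℝ)).mul_const y).const_add u
  have h2 : HasFDerivAt f (fderiv ℝ f (t, u)) ((fun l : ℝ => (t + l, u + l * y)) 0) := by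
    simpa using hf.hasFDerivAt
  exact h2.comp_hasDerivAt (0 : ℝ) h1

/-! ### Invariance of the orders under right-left equivalence. -/

namespace DevCurve

variable {t₀ : ℝ}

/-- The conormal of the osculating planes. -/
def conormal (D : DevCurve t₀) (t : ℝ) (x : E3) : ℝ :=
  (D.k t * D.h₂ t - D.h₃ t) * x 0 - D.k t * x 1 + x 2

variable {t₀' : ℝ}

/-- The asymmetric conclusion reflects two limits of the argument: the diagonal need not map to a
line on which the target Jacobian has its least order, and `σ` may interchange the singular curve
with the ruling over the base point. Both are repaired by applying the result to the inverse
equivalence. -/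
theorem orders_of_germEquiv (D : DevCurve t₀) (D' : DevCurve t₀') {a b d a' b' d' : ℕ}
    (hD : D.HasOrders a b d) (hD' : D'.HasOrders a' b' d')
    (h : GermEquiv D.surface (t₀, 0) D'.surface (t₀', 0)) :
    b' ≤ b ∧ (a = a' ∨ a = 0) ∧ d = d' := by
  obtain ⟨σ, σ', τ, τ', hσ, hτ, heq⟩ := h
  set q : ℝ × ℝ := (t₀, 0) with hq
  have hfst : Tendsto (Prod.fst : ℝ × ℝ → ℝ) (𝓝 q) (𝓝 t₀) := continuousAt_fst
  have hσ1 : Tendsto (fun z => (σ z).1) (𝓝 q) (𝓝 t₀') :=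
    (continuousAt_fst (p := (t₀', (0 : ℝ)))).tendsto.comp hσ.tendsto
  have hs1 : SmoothNear (fun z => (σ z).1) q :=
    SmoothNear.comp (g := Prod.fst) (contDiff_fst.smoothNear _) hσ.smooth
  have hv1 : SmoothNear (fun z => (σ z).2) q :=
    SmoothNear.comp (g := Prod.snd) (contDiff_snd.smoothNear _) hσ.smooth
  have hσq1 : (σ q).1 = t₀' := by rw [hσ.map_base]
  have hσq2 : (σ q).2 = 0 := by rw [hσ.map_base]
  have lift1 : ∀ {f : ℝ → ℝ}, SmoothNear f t₀' → SmoothNear (fun z => f (σ z).1) q := fun hf =>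
    SmoothNear.comp (f := fun z => (σ z).1) (by rw [hσq1]; exact hf) hs1
  -- the derivative of the target diffeomorphism along the surface, on the moving frame
  obtain ⟨T, hTdef⟩ : ∃ T : ℝ × ℝ → E3 →L[ℝ] E3, T = fun z => fderiv ℝ τ (D.surface z) := ⟨_, rfl⟩
  have hT : SmoothNear T q := hTdef ▸ SmoothNear.comp hτ.smooth.fderiv D.smoothNear_surface
  have hTq : T q = fderiv ℝ τ (D.surface q) := by rw [hTdef]
  obtain ⟨p, hpdef⟩ : ∃ p : ℝ × ℝ → E3, p = fun z => T z (D.tangent z.1) := ⟨_, rfl⟩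
  obtain ⟨r, hrdef⟩ : ∃ r : ℝ × ℝ → E3, r = fun z => T z (D.second z.1) := ⟨_, rfl⟩
  -- The third vector completes the frame and is the direction of the derivative of `second`, which
  -- is `k' • ![0, 0, 1]`.
  obtain ⟨w, hwdef⟩ : ∃ w : ℝ × ℝ → E3, w = fun z => T z ![0, 0, 1] := ⟨_, rfl⟩
  have hp : SmoothNear p q :=
    hpdef ▸ hT.clm_apply (SmoothNear.comp_fst (p := q) D.smoothNear_tangent)
  have hr : SmoothNear r q :=
    hrdef ▸ hT.clm_apply (SmoothNear.comp_fst (p := q) D.smoothNear_second)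
  have hw : SmoothNear w q := hwdef ▸ hT.clm_apply (smoothNear_const _ _)
  have hA : SmoothNear (fun z => fderiv ℝ σ z (1, 0)) q :=
    hσ.smooth.fderiv.clm_apply (smoothNear_const _ _)
  have hB : SmoothNear (fun z => fderiv ℝ σ z (0, 1)) q :=
    hσ.smooth.fderiv.clm_apply (smoothNear_const _ _)
  obtain ⟨st, hst⟩ : ∃ st : ℝ × ℝ → ℝ, st = fun z => (fderiv ℝ σ z (1, 0)).1 := ⟨_, rfl⟩
  obtain ⟨vt, hvt⟩ : ∃ vt : ℝ × ℝ → ℝ, vt = fun z => (fderiv ℝ σ z (1, 0)).2 := ⟨_, rfl⟩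
  obtain ⟨su, hsu⟩ : ∃ su : ℝ × ℝ → ℝ, su = fun z => (fderiv ℝ σ z (0, 1)).1 := ⟨_, rfl⟩
  obtain ⟨vu, hvu⟩ : ∃ vu : ℝ × ℝ → ℝ, vu = fun z => (fderiv ℝ σ z (0, 1)).2 := ⟨_, rfl⟩
  have hstc : ContinuousAt st q := hst ▸ (continuousAt_fst.comp hA.continuousAt)
  have hvtc : ContinuousAt vt q := hvt ▸ (continuousAt_snd.comp hA.continuousAt)
  have hsuc : ContinuousAt su q := hsu ▸ (continuousAt_fst.comp hB.continuousAt)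
  have hvuc : ContinuousAt vu q := hvu ▸ (continuousAt_snd.comp hB.continuousAt)
  have hdσ : ∀ z x y, fderiv ℝ σ z (x, y) = (x * st z + y * su z, x * vt z + y * vu z) := by
    intro z x y
    have : ((x, y) : ℝ × ℝ) = x • (1, 0) + y • (0, 1) := by simp
    rw [this, map_add, map_smul, map_smul, hst, hvt, hsu, hvu]
    ext <;> simp
  -- the chain rule
  have chain : ∀ᶠ z in 𝓝 q, ∀ x y : ℝ,
      T z (fderiv ℝ D.surface z (x, y)) = fderiv ℝ D'.surface (σ z) (fderiv ℝ σ z (x, y)) := by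
    have hsurf' : ∀ᶠ z in 𝓝 q, SmoothNear D'.surface (σ z) :=
      hσ.tendsto.eventually D'.smoothNear_surface.eventually
    filter_upwards [eventually_eventually_nhds.2 heq, hsurf', hσ.smooth.eventually,
      D.smoothNear_surface.eventually,
      D.smoothNear_surface.continuousAt.eventually hτ.smooth.eventually] with z h1 h2 h3 h4 h5 x y
    have l1 := h5.differentiableAt.hasFDerivAt.comp z h4.differentiableAt.hasFDerivAt
    have l2 := h2.differentiableAt.hasFDerivAt.comp z h3.differentiableAt.hasFDerivAt
    have l3 := l1.unique (l2.congr_of_eventuallyEq h1)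
    have l4 := congrArg (fun L : ℝ × ℝ →L[ℝ] E3 => L (x, y)) l3
    rw [hTdef]
    exact l4
  have rows : ∀ᶠ z in 𝓝 q, ∀ x y : ℝ,
      (x * deriv D.c₁ z.1 + y) • p z + (x * (z.2 * deriv D.h₂ z.1)) • r z =
      ((x * st z + y * su z) * deriv D'.c₁ (σ z).1 + (x * vt z + y * vu z)) • D'.tangent (σ z).1 +
      ((x * st z + y * su z) * ((σ z).2 * deriv D'.h₂ (σ z).1)) • D'.second (σ z).1 := by
    filter_upwards [chain, D.fderiv_surface, hσ.tendsto.eventually D'.fderiv_surface]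
      with z h1 h2 h3 x y
    have h4 := h1 x y
    rw [h2, hdσ, h3] at h4
    simp only [map_add, map_smul] at h4
    rw [hpdef, hrdef]
    simp only [add_smul, mul_smul]
    simp only [smul_add, add_smul, mul_smul] at h4
    rw [add_right_comm, h4]
    abel
  have rowU : ∀ᶠ z in 𝓝 q, p z = (su z * deriv D'.c₁ (σ z).1 + vu z) • D'.tangent (σ z).1 +
      (su z * ((σ z).2 * deriv D'.h₂ (σ z).1)) • D'.second (σ z).1 := by
    filter_upwards [rows] with z hz
    simpa using hz 0 1
  have rowT : ∀ᶠ z in 𝓝 q, deriv D.c₁ z.1 • p z + (z.2 * deriv D.h₂ z.1) • r z =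
      (st z * deriv D'.c₁ (σ z).1 + vt z) • D'.tangent (σ z).1 +
      (st z * ((σ z).2 * deriv D'.h₂ (σ z).1)) • D'.second (σ z).1 := by
    filter_upwards [rows] with z hz
    simpa using hz 1 0
  -- osculating planes correspond
  have conp : ∀ᶠ z in 𝓝 q, D'.conormal (σ z).1 (p z) = 0 := by
    filter_upwards [rowU] with z hz
    rw [hz]
    simp [conormal, tangent, second]
    ring
  have hrcomp : SmoothNear (fun z => D'.conormal (σ z).1 (r z)) q :=
    (((((lift1 D'.smooth_k).mul (lift1 D'.smooth_h₂)).sub (lift1 D'.smooth_h₃)).mul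
      (hr.apply 0)).sub ((lift1 D'.smooth_k).mul (hr.apply 1))).add (hr.apply 2)
  have conr : ∀ᶠ z in 𝓝 q, D'.conormal (σ z).1 (r z) = 0 := by
    -- Off the axes `u h₂' ≠ 0`, so `rowT` and `conp` put `r` in the target osculating plane.
    refine eventually_eq_zero_of_off_axes hrcomp ?_
    have hne := hD.order_h₂.ne_zero
    rw [eventually_nhdsWithin_iff] at hne
    filter_upwards [rowT, conp, hfst.eventually hne] with z h1 h2 h3 ht hu
    have h4 := congrArg (D'.conormal (σ z).1) h1
    have h5 : (z.2 * deriv D.h₂ z.1) * D'.conormal (σ z).1 (r z) = 0 := by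
      simp [conormal, tangent, second] at h4 h2
      simp only [conormal]
      linear_combination h4 - deriv D.c₁ z.1 * h2
    exact (mul_eq_zero.1 h5).resolve_left (mul_ne_zero hu (h3 ht))
  -- Jacobians correspond
  have jac : ∀ᶠ z in 𝓝 q, (z.2 * deriv D.h₂ z.1) * (p z 0 * r z 1 - p z 1 * r z 0) =
      ((σ z).2 * deriv D'.h₂ (σ z).1) * (st z * vu z - vt z * su z) := by
    -- In coordinates 0 and 1 the pair `tangent`, `second` has determinant 1, so the minors of the
    -- two rows are the Jacobians with no further factor.
    filter_upwards [rowU, rowT] with z h1 h2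
    have a0 := congrFun h1 0
    have a1 := congrFun h1 1
    have b0 := congrFun h2 0
    have b1 := congrFun h2 1
    simp [tangent, second] at a0 a1 b0 b1
    have : (z.2 * deriv D.h₂ z.1) * (p z 0 * r z 1 - p z 1 * r z 0) =
        p z 0 * (deriv D.c₁ z.1 * p z 1 + (z.2 * deriv D.h₂ z.1) * r z 1) -
        p z 1 * (deriv D.c₁ z.1 * p z 0 + (z.2 * deriv D.h₂ z.1) * r z 0) := by ring
    rw [this, b0, b1, a0, a1]
    ring
  -- non-degeneracy at the base point
  have Tinj : ∀ x, T q x = 0 → x = 0 := fun x hx => hτ.fderiv_eq_zero (by rw [← hTq]; exact hx)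
  -- In the osculating plane coordinate 2 is a function of coordinates 0 and 1, because the conormal
  -- has coefficient 1 there. So the independence of `p` and `r`, due to the injectivity of `dτ`, is
  -- visible in the first two coordinates.
  have comb : ∀ x y : ℝ, x * p q 0 + y * r q 0 = 0 → x * p q 1 + y * r q 1 = 0 → x = 0 ∧ y = 0 := by
    intro x y h0 h1
    have c1 := conp.self_of_nhds
    have c2 := conr.self_of_nhds
    simp only [conormal] at c1 c2
    have h2 : x * p q 2 + y * r q 2 = 0 := by
      linear_combination x * c1 + y * c2 - (D'.k (σ q).1 * D'.h₂ (σ q).1 - D'.h₃ (σ q).1) * h0 +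
        D'.k (σ q).1 * h1
    have h3 : T q (x • D.tangent t₀ + y • D.second t₀) = 0 := by
      have e1 : T q (D.tangent t₀) = p q := by rw [hpdef]
      have e2 : T q (D.second t₀) = r q := by rw [hrdef]
      rw [map_add, map_smul, map_smul, e1, e2]
      ext i
      fin_cases i
      · simpa using h0
      · simpa using h1
      · simpa using h2
    have h4 := Tinj _ h3
    have h5 := congrFun h4 0
    have h6 := congrFun h4 1
    simp [tangent, second] at h5 h6
    rw [h5] at h6
    exact ⟨h5, by simpa using h6⟩
  have hΔ : p q 0 * r q 1 - p q 1 * r q 0 ≠ 0 := by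
    intro h0
    have k1 := comb (r q 0) (- p q 0) (by ring) (by linear_combination -h0)
    have k2 := comb (r q 1) (- p q 1) (by linear_combination h0) (by ring)
    have k3 := comb 1 0 (by linear_combination -k1.2) (by linear_combination -k2.2)
    exact one_ne_zero k3.1
  have σinj : ∀ x y : ℝ, x * st q + y * su q = 0 → x * vt q + y * vu q = 0 → x = 0 ∧ y = 0 := by
    intro x y h1 h2
    have : fderiv ℝ σ q (x, y) = 0 := by rw [hdσ, h1, h2]; rfl
    simpa using hσ.fderiv_eq_zero this
  have hδ : st q * vu q - vt q * su q ≠ 0 := by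
    intro h0
    have k1 := σinj (su q) (- st q) (by ring) (by linear_combination -h0)
    have k2 := σinj (vu q) (- vt q) (by linear_combination h0) (by ring)
    have k3 := σinj 1 0 (by linear_combination -k1.2) (by linear_combination -k2.2)
    exact one_ne_zero k3.1
  -- At the base point `v = 0`, so `p` is a multiple of the target tangent direction.
  have hp1 : p q 1 = D'.h₂ t₀' * p q 0 := by
    have h1 := rowU.self_of_nhds
    rw [hσq2, hσq1] at h1
    have a0 := congrFun h1 0
    have a1 := congrFun h1 1
    simp [tangent, second] at a0 a1
    rw [a0, a1]; ring
  have hΔ' : p q 0 * (r q 1 - D'.h₂ t₀' * r q 0) ≠ 0 := by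
    intro h0
    apply hΔ
    rw [hp1]; linear_combination h0
  have hp0 : p q 0 ≠ 0 := left_ne_zero_of_mul hΔ'
  have hr10 : r q 1 - D'.h₂ t₀' * r q 0 ≠ 0 := right_ne_zero_of_mul hΔ'
  -- Otherwise the whole image of `dτ` would lie in the osculating plane, against surjectivity.
  have hcw : D'.conormal t₀' (w q) ≠ 0 := by
    intro h0
    obtain ⟨x, hx⟩ : ∃ x, T q x = ![0, 0, 1] :=
      ⟨_, by rw [hTq]; exact hτ.symm.fderiv_inv_fderiv ![0, 0, 1]⟩
    have hdec : x = x 0 • D.tangent t₀ + (x 1 - x 0 * D.h₂ t₀) • D.second t₀ +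
        (x 2 - x 0 * D.h₃ t₀ - (x 1 - x 0 * D.h₂ t₀) * D.k t₀) • ![0, 0, 1] := by
      ext i
      fin_cases i <;> simp [tangent, second]
    rw [hdec] at hx
    have e1 : T q (D.tangent t₀) = p q := by rw [hpdef]
    have e2 : T q (D.second t₀) = r q := by rw [hrdef]
    have e3 : T q ![0, 0, 1] = w q := by rw [hwdef]
    simp only [map_add, map_smul, e1, e2, e3] at hx
    have h1 := congrArg (D'.conormal t₀') hx
    have c1 := conp.self_of_nhds
    have c2 := conr.self_of_nhds
    rw [hσq1] at c1 c2
    simp [conormal] at h1 c1 c2 h0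
    refine one_ne_zero (α := ℝ) ?_
    linear_combination -h1 + x 0 * c1 + (x 1 - x 0 * D.h₂ t₀) * c2 +
      (x 2 - x 0 * D.h₃ t₀ - (x 1 - x 0 * D.h₂ t₀) * D.k t₀) * h0
  -- the kernel direction
  have hζ : st q - deriv D.c₁ t₀ * su q ≠ 0 := by
    intro h0
    -- The left side is zero on the kernel vector. If the `s`-component of its image under `dσ`
    -- vanished, the row would make the `v`-component vanish too, against the injectivity of `dσ`.
    have h1 := (rows.self_of_nhds) 1 (- deriv D.c₁ t₀)
    rw [hσq2] at h1
    have a0 := congrFun h1 0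
    simp [tangent, second, hq] at a0
    have := σinj 1 (- deriv D.c₁ t₀) (by linear_combination h0)
      (by rw [← hq] at a0; linear_combination -a0 - deriv D'.c₁ (σ q).1 * h0)
    exact one_ne_zero this.1
  have hax : Tendsto (fun t : ℝ => (t, (0 : ℝ))) (𝓝 t₀) (𝓝 q) :=
    (continuous_id.prodMk continuous_const).tendsto t₀
  -- This is the derivative of `conr` at `(t, 0)` along the kernel vector `(1, -c₁')`. The surface
  -- is stationary to first order in that direction, hence so is `T`, and `r` varies only through
  -- `second`. On the target side `h₃' = k h₂'` leaves only the terms in `k'`.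
  have key : ∀ᶠ t in 𝓝 t₀, deriv D.k t * D'.conormal (σ (t, 0)).1 (w (t, 0)) =
      deriv D'.k (σ (t, 0)).1 * ((st (t, 0) - deriv D.c₁ t * su (t, 0)) *
        (r (t, 0) 1 - D'.h₂ (σ (t, 0)).1 * r (t, 0) 0)) := by
    filter_upwards [hax.eventually (eventually_eventually_nhds.2 conr), D.smooth_k.eventually,
      hax.eventually D.smoothNear_surface.eventually, hax.eventually hσ.smooth.eventually,
      hax.eventually (D.smoothNear_surface.continuousAt.eventually hτ.smooth.fderiv.eventually),
      hax.eventually D.fderiv_surface, hax.eventually (hσ1.eventually D'.smooth_k.eventually),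
      hax.eventually (hσ1.eventually D'.smooth_h₂.eventually),
      hax.eventually (hσ1.eventually D'.smooth_h₃.eventually),
      hax.eventually (hσ1.eventually D'.deriv_h₃)]
      with t hcon hk hsurf hσs hτs hfd hk' hh₂ hh₃ hh₃'
    set y := - deriv D.c₁ t with hy
    have s1 := hasDerivAt_along_line hσs.differentiableAt y
    rw [hdσ] at s1
    have s2 : HasDerivAt (fun l : ℝ => (σ (t + l, 0 + l * y)).1) (1 * st (t, 0) + y * su (t, 0)) 0 :=
      s1.fst
    have g0 : fderiv ℝ D.surface (t, 0) (1, y) = 0 := by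
      rw [hfd]; ext i; simp [hy]
    have g1 := hasDerivAt_along_line hsurf.differentiableAt y
    rw [g0] at g1
    have T1 : HasDerivAt (fun l : ℝ => T (t + l, 0 + l * y)) 0 0 := by
      have e : HasFDerivAt (fderiv ℝ τ) (fderiv ℝ (fderiv ℝ τ) (D.surface (t, 0)))
          ((fun l : ℝ => D.surface (t + l, 0 + l * y)) 0) := by
        simpa using hτs.differentiableAt.hasFDerivAt
      have := e.comp_hasDerivAt (0 : ℝ) g1
      rw [map_zero] at this
      rw [hTdef]; exact this
    have V1 : HasDerivAt (fun l : ℝ => D.second (t + l)) ![0, 0, deriv D.k t] 0 := by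
      rw [hasDerivAt_pi]
      intro i
      fin_cases i
      · exact hasDerivAt_const _ _
      · exact hasDerivAt_const _ _
      · have e : HasDerivAt D.k (deriv D.k t) (t + 0) := by
          simpa using hk.differentiableAt.hasDerivAt
        exact e.comp_const_add t 0
    have R1 := T1.clm_apply V1
    have R2 : ∀ i, HasDerivAt (fun l : ℝ => r (t + l, 0 + l * y) i) (deriv D.k t * w (t, 0) i) 0 := by
      intro i
      have e := hasDerivAt_pi.1 R1 i
      rw [hrdef]
      refine e.congr_deriv ?_
      have : (![0, 0, deriv D.k t] : E3) = deriv D.k t • ![0, 0, 1] := by simp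
      simp only [hwdef, add_zero, zero_mul, _root_.zero_apply, zero_add, this,
        map_smul, Pi.smul_apply, smul_eq_mul]
    have lift : ∀ {f : ℝ → ℝ}, SmoothNear f (σ (t, 0)).1 →
        HasDerivAt (fun l : ℝ => f (σ (t + l, 0 + l * y)).1)
          (deriv f (σ (t, 0)).1 * (1 * st (t, 0) + y * su (t, 0))) 0 := by
      intro f hf
      have e : HasDerivAt f (deriv f (σ (t, 0)).1) ((fun l : ℝ => (σ (t + l, 0 + l * y)).1) 0) := by
        simpa using hf.differentiableAt.hasDerivAt
      exact e.comp (0 : ℝ) s2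
    have tot := (((((lift hk').fun_mul (lift hh₂)).fun_sub (lift hh₃)).fun_mul (R2 0)).fun_sub
      ((lift hk').fun_mul (R2 1))).fun_add (R2 2)
    have line : Tendsto (fun l : ℝ => (t + l, 0 + l * y)) (𝓝 0) (𝓝 (t, 0)) := by
      have : Continuous (fun l : ℝ => (t + l, 0 + l * y)) := by fun_prop
      simpa using this.tendsto 0
    have zero : HasDerivAt (fun _ : ℝ => (0 : ℝ)) _ 0 :=
      tot.congr_of_eventuallyEq ((line.eventually hcon).mono fun l hl => hl.symm)
    have := zero.unique (hasDerivAt_const _ _)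
    simp only [add_zero, zero_mul] at this
    rw [hh₃'] at this
    simp only [conormal]
    linear_combination this
  have curve : ∀ᶠ t in 𝓝 t₀, HasDerivAt (fun t => (σ (t, 0)).1) (st (t, 0)) t ∧
      HasDerivAt (fun t => (σ (t, 0)).2) (vt (t, 0)) t := by
    filter_upwards [hax.eventually hσ.smooth.eventually] with t ht
    have e := ht.differentiableAt.hasFDerivAt.comp_hasDerivAt t
      ((hasDerivAt_id t).prodMk (hasDerivAt_const t (0 : ℝ)))
    rw [hdσ] at e
    simp only [one_mul, zero_mul, add_zero] at e
    exact ⟨e.fst, e.snd⟩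
  -- On `u = 0` the left side of `jac` vanishes: singular points go to singular points.
  have split : ∀ᶠ t in 𝓝 t₀, (σ (t, 0)).2 = 0 ∨ deriv D'.h₂ (σ (t, 0)).1 = 0 := by
    have hδc : ContinuousAt (fun z => st z * vu z - vt z * su z) q :=
      (hstc.mul hvuc).sub (hvtc.mul hsuc)
    filter_upwards [hax.eventually jac, hax.eventually (hδc.eventually_ne hδ)] with t h1 h2
    simp only [zero_mul] at h1
    exact mul_eq_zero.1 ((mul_eq_zero.1 h1.symm).resolve_right h2)
  have hs0 := curve.self_of_nhds.1
  have hv0 := curve.self_of_nhds.2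
  have hax1 : Tendsto (fun t => (σ (t, 0)).1) (𝓝 t₀) (𝓝 t₀') := hσ1.comp hax
  have cont : ∀ {f : ℝ × ℝ → ℝ}, ContinuousAt f q → ContinuousAt (fun t => f (t, 0)) t₀ :=
    fun hf => hf.tendsto.comp hax
  have hpc := (hp.apply 0).continuousAt
  have hwc : ContinuousAt (fun z => D'.conormal (σ z).1 (w z)) q :=
    ((((((lift1 D'.smooth_k).mul (lift1 D'.smooth_h₂)).sub (lift1 D'.smooth_h₃)).mul
      (hw.apply 0)).sub ((lift1 D'.smooth_k).mul (hw.apply 1))).add (hw.apply 2)).continuousAt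
  have hcc : ContinuousAt (fun z : ℝ × ℝ => (st z - deriv D.c₁ z.1 * su z) *
        (r z 1 - D'.h₂ (σ z).1 * r z 0)) q :=
    (hstc.sub ((SmoothNear.comp_fst (p := q) D.smooth_c₁.deriv).continuousAt.mul hsuc)).mul
      ((hr.apply 1).sub ((lift1 D'.smooth_h₂).mul (hr.apply 0))).continuousAt
  have hcc0 : (st q - deriv D.c₁ q.1 * su q) * (r q 1 - D'.h₂ (σ q).1 * r q 0) ≠ 0 := by
    rw [hσq1]; exact mul_ne_zero hζ hr10
  have hwc0 : D'.conormal (σ q).1 (w q) ≠ 0 := by rw [hσq1]; exact hcw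
  refine ⟨?_, ?_⟩
  · -- compare the Jacobians along the diagonal
    obtain ⟨f, hf, hf0, hfe⟩ := hD.order_h₂
    obtain ⟨f', hf', hf0', hfe'⟩ := hD'.order_h₂
    have hdiag : Tendsto (fun t : ℝ => (t, t - t₀)) (𝓝 t₀) (𝓝 q) := by
      have : Continuous (fun t : ℝ => (t, t - t₀)) := by fun_prop
      simpa [hq] using this.tendsto t₀
    have e := HasFDerivAt.comp_hasDerivAt (f := fun t : ℝ => (t, t - t₀)) t₀
      (by simpa [hq] using hσ.smooth.differentiableAt.hasFDerivAt)
      ((hasDerivAt_id t₀).prodMk ((hasDerivAt_id t₀).sub_const t₀))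
    obtain ⟨α, hα, hα'⟩ := exists_slope e.fst
    obtain ⟨β, hβ, hβ'⟩ := exists_slope e.snd
    simp only [Function.comp_apply, sub_self, ← hq, hσq1, hσq2, sub_zero] at hα' hβ'
    have cdiag : ∀ {f : ℝ × ℝ → ℝ}, ContinuousAt f q →
        Tendsto (fun t => f (t, t - t₀)) (𝓝[≠] t₀) (𝓝 (f q)) :=
      fun hf => (hf.tendsto.comp hdiag).mono_left nhdsWithin_le_nhds
    have hΔc : ContinuousAt (fun z => p z 0 * r z 1 - p z 1 * r z 0) q :=
      (((hp.apply 0).mul (hr.apply 1)).sub ((hp.apply 1).mul (hr.apply 0))).continuousAt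
    have hδc : ContinuousAt (fun z => f' (σ z).1 * (st z * vu z - vt z * su z)) q :=
      (lift1 hf').continuousAt.mul ((hstc.mul hvuc).sub (hvtc.mul hsuc))
    have lim1 := (hf.continuousAt.tendsto.mono_left (nhdsWithin_le_nhds (s := {t₀}ᶜ))).mul
      (cdiag hΔc)
    -- The slopes of `s` and `v` along the diagonal may tend to zero, so only `b' ≤ b` follows.
    have lim2 := (hβ.mul (hα.pow b')).mul (cdiag hδc)
    have := pow_exponent_le (k := b + 1) (l := b' + 1) lim1 (mul_ne_zero hf0 hΔ) lim2 ?_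
    · omega
    · filter_upwards [nhdsWithin_le_nhds ((hdiag.eventually jac).and
        (hfe.and (hdiag.eventually (hσ1.eventually hfe'))))] with t ht
      obtain ⟨h1, h2, h3⟩ := ht
      rw [h2, h3, hα', hβ'] at h1
      rw [mul_pow] at h1
      linear_combination h1
  · by_cases hst0 : st q = 0
    · -- the singular curve is exchanged with the ruling over the base point
      have hvt0 : vt q ≠ 0 := by
        intro h0
        exact one_ne_zero (σinj 1 0 (by rw [hst0]; ring) (by rw [h0]; ring)).1
      have hne : ∀ᶠ t in 𝓝[≠] t₀, (σ (t, 0)).2 ≠ 0 := by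
        have := hv0.eventually_ne (c := (σ (t₀, 0)).2) hvt0
        simpa only [← hq, hσq2] using this
      have hconst : ∀ᶠ t in 𝓝[≠] t₀, (σ (t, 0)).1 = t₀' := by
        have h2 := hD'.order_h₂.ne_zero
        rw [eventually_nhdsWithin_iff] at h2
        filter_upwards [hne, nhdsWithin_le_nhds (split.and (hax1.eventually h2))] with t h3 h4
        by_contra h5
        exact h4.2 h5 (h4.1.resolve_left h3)
      refine ⟨Or.inr ?_, ?_⟩
      · have h1 := congrFun rowT.self_of_nhds 0
        rw [hst0] at h1
        simp [tangent, second, hq] at h1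
        refine hD.order_c₁.eq_zero_of_apply_ne_zero fun h0 => hvt0 ?_
        rw [h0] at h1
        rw [hq, ← h1, zero_mul]
      -- Here `s` is constant off `t₀`, so `key` makes `k'` a multiple of the number `D'.k'(t₀')`.
      -- This number is nonzero because `k'` has finite order, and `key` at `t₀` then gives `k'(t₀)
      -- ≠ 0`: both orders are zero.
      · have h1 : deriv D'.k t₀' ≠ 0 := by
          obtain ⟨t, h2, h3, h4, h5⟩ := (hD.order_k.ne_zero.and (hconst.and
            (nhdsWithin_le_nhds (key.and ((cont hwc).eventually_ne hwc0))))).exists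
          intro h0
          rw [h3, h0, zero_mul] at h4
          rw [h3] at h5
          exact mul_ne_zero h2 h5 h4
        have h2 : deriv D.k t₀ ≠ 0 := by
          have h3 := key.self_of_nhds
          intro h0
          rw [h0, zero_mul, ← hq, hσq1] at h3
          rw [hσq1] at hcc0
          exact mul_ne_zero h1 hcc0 h3.symm
        rw [hD.order_k.eq_zero_of_apply_ne_zero h2, hD'.order_k.eq_zero_of_apply_ne_zero h1]
    · have hne : ∀ᶠ t in 𝓝[≠] t₀, (σ (t, 0)).1 ≠ t₀' := by
        have := hs0.eventually_ne (c := (σ (t₀, 0)).1) hst0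
        simpa only [← hq, hσq1] using this
      -- Now `s` leaves `t₀'` at once, where `h₂' ≠ 0`, so `split` sends the singular curve into the
      -- singular curve.
      have hv : ∀ᶠ t in 𝓝 t₀, (σ (t, 0)).2 = 0 := by
        refine eventually_nhds_of_punctured (g := fun _ => 0) hv0.continuousAt continuousAt_const ?_
        have h2 := hD'.order_h₂.ne_zero
        rw [eventually_nhdsWithin_iff] at h2
        filter_upwards [hne, nhdsWithin_le_nhds (split.and (hax1.eventually h2))] with t h3 h4
        exact h4.1.resolve_right (h4.2 h3)
      have hvt0 : ∀ᶠ t in 𝓝 t₀, vt (t, 0) = 0 := by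
        filter_upwards [curve, eventually_eventually_nhds.2 hv] with t h1 h2
        exact (h1.2.congr_of_eventuallyEq (h2.mono fun _ h => h.symm)).unique
          (hasDerivAt_const t (0 : ℝ))
      refine ⟨Or.inl ?_, ?_⟩
      · refine hD.order_c₁.eq_of_comp hs0 hst0 (g := deriv D'.c₁) (A := fun t => p (t, 0) 0)
          (B := fun t => st (t, 0)) (by rw [← hq, hσq1]; exact hD'.order_c₁) (cont hpc) hp0
          (cont hstc) hst0 ?_
        -- With `u`, `v` and `∂v/∂t` all zero, coordinate 0 of `rowT` reads `c₁'(t) p₀ = (∂s/∂t)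
        -- c₁'(s)`.
        filter_upwards [hax.eventually rowT, hvt0] with t h1 h2
        have h3 := congrFun h1 0
        simp [tangent, second, h2] at h3
        rw [h3]; ring
      · exact hD.order_k.eq_of_comp hs0 hst0 (g := deriv D'.k)
          (by rw [← hq, hσq1]; exact hD'.order_k) (cont hwc) hwc0 (cont hcc) hcc0 key

theorem orders_unique (D : DevCurve t₀) (D' : DevCurve t₀') {a b d a' b' d' : ℕ}
    (hD : D.HasOrders a b d) (hD' : D'.HasOrders a' b' d')
    (h : GermEquiv D.surface (t₀, 0) D'.surface (t₀', 0)) : a = a' ∧ b = b' ∧ d = d' := by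
  obtain ⟨h1, h2, h3⟩ := orders_of_germEquiv D D' hD hD' h
  obtain ⟨h4, h5, -⟩ := orders_of_germEquiv D' D hD' hD (h.symm D.smoothNear_surface.continuousAt)
  omega

end DevCurve

/-! ### Echelon forms and ranks -/

/-- Three linear coordinates adapted to the flag swept out by a spanning sequence. -/
theorem exists_echelon (v : ℕ → E3) (hv : Submodule.span ℝ (Set.range v) = ⊤) :
    ∃ (L : E3 ≃ₗ[ℝ] E3) (k : Fin 3 → ℕ), StrictMono k ∧ (∀ i, ∀ j < k i, L (v j) i = 0) ∧
      ∀ i, L (v (k i)) i ≠ 0 := by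
  have small : ∀ S : Submodule ℝ E3, S ≠ ⊤ → ∃ j, v j ∉ S := by
    intro S hS
    by_contra! h
    refine hS (top_unique (hv ▸ Submodule.span_le.2 ?_))
    rintro _ ⟨j, rfl⟩
    exact h j
  have hfin : ∀ s : Finset E3, s.card < 3 → Submodule.span ℝ (s : Set E3) ≠ ⊤ := by
    intro s hs h
    have h1 := finrank_span_finset_le_card (R := ℝ) s
    rw [Set.finrank, h, finrank_top, Module.finrank_fin_fun] at h1
    omega
  classical
  -- The indices `k0 < k1 < k2` are those at which the span of the sequence grows. The vectors there
  -- form a basis, and `L` takes coordinates in it.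
  have e0 : ∃ j, v j ∉ (⊥ : Submodule ℝ E3) := small _ bot_ne_top
  obtain ⟨k0, h0, m0⟩ : ∃ k, v k ∉ (⊥ : Submodule ℝ E3) ∧ ∀ j < k, v j ∈ (⊥ : Submodule ℝ E3) :=
    ⟨Nat.find e0, Nat.find_spec e0, fun j hj => not_not.1 (Nat.find_min e0 hj)⟩
  have e1 : ∃ j, v j ∉ Submodule.span ℝ {v k0} :=
    small _ (by simpa using hfin {v k0} (by simp))
  obtain ⟨k1, h1, m1⟩ : ∃ k, v k ∉ Submodule.span ℝ {v k0} ∧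
      ∀ j < k, v j ∈ Submodule.span ℝ {v k0} :=
    ⟨Nat.find e1, Nat.find_spec e1, fun j hj => not_not.1 (Nat.find_min e1 hj)⟩
  have e2 : ∃ j, v j ∉ Submodule.span ℝ {v k0, v k1} :=
    small _ (by simpa using hfin {v k0, v k1} (Finset.card_le_two.trans_lt (by norm_num)))
  obtain ⟨k2, h2, m2⟩ : ∃ k, v k ∉ Submodule.span ℝ {v k0, v k1} ∧
      ∀ j < k, v j ∈ Submodule.span ℝ {v k0, v k1} :=
    ⟨Nat.find e2, Nat.find_spec e2, fun j hj => not_not.1 (Nat.find_min e2 hj)⟩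
  have lt01 : k0 < k1 := by
    refine lt_of_le_of_ne (not_lt.1 fun h => h1 ?_) fun h => h1 ?_
    · rw [(Submodule.mem_bot ℝ).1 (m0 _ h)]; exact zero_mem _
    · rw [← h]; exact Submodule.mem_span_singleton_self _
  have lt12 : k1 < k2 := by
    refine lt_of_le_of_ne (not_lt.1 fun h => h2 ?_) fun h => h2 ?_
    · exact Submodule.span_mono (by simp) (m1 _ h)
    · rw [← h]; exact Submodule.subset_span (by simp)
  have li : LinearIndependent ℝ ![v k0, v k1, v k2] := by
    refine Fintype.linearIndependent_iff.2 fun g hg => ?_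
    simp only [Fin.sum_univ_three, Matrix.cons_val] at hg
    have g2 : g 2 = 0 := by
      by_contra hne
      refine h2 (Submodule.mem_span_pair.2 ⟨-(g 0 / g 2), -(g 1 / g 2), funext fun i => ?_⟩)
      have := congrFun hg i
      simp only [Pi.add_apply, Pi.smul_apply, smul_eq_mul, Pi.zero_apply] at this ⊢
      field_simp
      linear_combination -this
    have g1 : g 1 = 0 := by
      by_contra hne
      refine h1 (Submodule.mem_span_singleton.2 ⟨-(g 0 / g 1), funext fun i => ?_⟩)
      have := congrFun hg i
      simp only [g2, Pi.add_apply, Pi.smul_apply, smul_eq_mul, Pi.zero_apply] at this ⊢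
      field_simp
      linear_combination -this
    have g0 : g 0 = 0 := by
      by_contra hne
      rw [g1, g2, zero_smul, zero_smul, add_zero, add_zero] at hg
      exact h0 ((Submodule.mem_bot ℝ).2 ((smul_eq_zero.1 hg).resolve_left hne))
    intro i
    fin_cases i
    · exact g0
    · exact g1
    · exact g2
  let b := basisOfLinearIndependentOfCardEqFinrank li (by simp)
  have hb0 : b 0 = v k0 := by simp [b]
  have hb1 : b 1 = v k1 := by simp [b]
  have hb2 : b 2 = v k2 := by simp [b]
  have L0 : b.equivFun (v k0) = Pi.single 0 1 := by
    rw [← hb0]; ext i; simp [Pi.single_apply, eq_comm]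
  have L1 : b.equivFun (v k1) = Pi.single 1 1 := by
    rw [← hb1]; ext i; simp [Pi.single_apply, eq_comm]
  have L2 : b.equivFun (v k2) = Pi.single 2 1 := by
    rw [← hb2]; ext i; simp [Pi.single_apply, eq_comm]
  refine ⟨b.equivFun, ![k0, k1, k2], ?_, ?_, ?_⟩
  · intro i j hij
    fin_cases i <;> fin_cases j <;> simp_all
    omega
  · intro i j hj
    fin_cases i
    · have := m0 j (by simpa using hj)
      rw [(Submodule.mem_bot ℝ).1 this]; simp
    · obtain ⟨x, hx⟩ := Submodule.mem_span_singleton.1 (m1 j (by simpa using hj))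
      rw [← hx, map_smul, L0]; simp
    · obtain ⟨x, y, hx⟩ := Submodule.mem_span_pair.1 (m2 j (by simpa using hj))
      rw [← hx, map_add, map_smul, map_smul, L0, L1]; simp
  · intro i
    fin_cases i
    · show b.equivFun (v k0) 0 ≠ 0
      rw [L0]; simp
    · show b.equivFun (v k1) 1 ≠ 0
      rw [L1]; simp
    · show b.equivFun (v k2) 2 ≠ 0
      rw [L2]; simp

/-- After multiplication by `l` the matrix is in echelon form with pivots at the columns `k i`, so
the rank of its first `r` columns is the number of pivots among them. Columns count from 0. -/
theorem rank_echelon (v : ℕ → E3) (l : Matrix (Fin 3) (Fin 3) ℝ) (k : Fin 3 → ℕ)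
    (hk : StrictMono k) (hz : ∀ i, ∀ j < k i, l.mulVec (v j) i = 0)
    (hn : ∀ i, l.mulVec (v (k i)) i ≠ 0) (i : Fin 3) (r : ℕ) :
    (r ≤ k i → (Matrix.of fun i (j : Fin r) => v j i).rank ≤ i) ∧
    (k i < r → (i : ℕ) + 1 ≤ (Matrix.of fun i (j : Fin r) => v j i).rank) := by
  set M : Matrix (Fin 3) (Fin r) ℝ := Matrix.of fun i (j : Fin r) => v j i with hM
  have entry : ∀ i j, (l * M) i j = l.mulVec (v j) i := fun i j => rfl
  constructor
  · intro hr
    -- A left null vector of `l`, paired with columns `k 0`, `k 1`, `k 2` in turn, loses its entries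
    -- one by one.
    have hdet : l.det ≠ 0 := by
      intro h0
      obtain ⟨w, hw, hwl⟩ := Matrix.exists_vecMul_eq_zero_iff.2 h0
      have h1 : ∀ j, w ⬝ᵥ l.mulVec (v j) = 0 := fun j => by
        rw [Matrix.dotProduct_mulVec, hwl, zero_dotProduct]
      have h01 : k 0 < k 1 := hk (by decide)
      have h12 : k 1 < k 2 := hk (by decide)
      have e0 := h1 (k 0)
      have e1 := h1 (k 1)
      have e2 := h1 (k 2)
      simp only [dotProduct, Fin.sum_univ_three] at e0 e1 e2
      rw [hz 1 _ h01, hz 2 _ (h01.trans h12)] at e0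
      rw [hz 2 _ h12] at e1
      have w0 : w 0 = 0 := by simpa [hn 0] using e0
      have w1 : w 1 = 0 := by simpa [hn 1, w0] using e1
      have w2 : w 2 = 0 := by simpa [hn 2, w0, w1] using e2
      apply hw
      ext i
      fin_cases i
      · exact w0
      · exact w1
      · exact w2
    rw [← Matrix.rank_mul_eq_right_of_det_ne_zero l M hdet]
    -- Rows `i` and below vanish when `r ≤ k i`, so a projection of rank `i` fixes `l * M`.
    have hdiag : l * M = Matrix.diagonal (fun i' => if i' < i then (1 : ℝ) else 0) * (l * M) := by
      ext i' j
      rw [Matrix.diagonal_mul]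
      split_ifs with h
      · rw [one_mul]
      · rw [entry, hz i' j (lt_of_lt_of_le j.2 (hr.trans (hk.monotone (not_lt.1 h)))), mul_zero]
    rw [hdiag]
    refine (Matrix.rank_mul_le_left _ _).trans ?_
    classical
    rw [Matrix.rank_diagonal]
    simp only [ne_eq, ite_eq_right_iff, one_ne_zero, imp_false, not_not]
    rw [Fintype.card_subtype]
    exact (Finset.card_le_card (t := Finset.Iio i) fun j hj => by simpa using hj).trans (by simp)
  · intro hr
    refine le_trans ?_ (Matrix.rank_mul_le_right l M)
    have hle : (i : ℕ) + 1 ≤ 3 := i.2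
    have hlt : ∀ j : Fin ((i : ℕ) + 1), k (Fin.castLE hle j) < r := fun j =>
      lt_of_le_of_lt (hk.monotone (Fin.le_def.2 (by simpa using Nat.lt_succ_iff.1 j.2))) hr
    have h1 := Matrix.rank_submatrix_le (l * M) (Fin.castLE hle)
      (fun j : Fin ((i : ℕ) + 1) => (⟨k (Fin.castLE hle j), hlt j⟩ : Fin r))
    refine le_trans ?_ h1
    rw [Matrix.rank_of_det_ne_zero]
    · simp
    · rw [Matrix.det_of_isUpperTriangular]
      · exact Finset.prod_ne_zero_iff.2 fun j _ => hn _
      · intro i' j hij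
        exact hz _ _ (hk ((Fin.castLE_lt_castLE_iff hle).2 hij))

/-! ### Affine coordinates in terms of homogeneous coordinates -/

theorem HasCoords.exists_rep {p : RP3} {x : V4} (h : HasCoords p x) :
    ∃ a : ℝ, a ≠ 0 ∧ p.rep = a • x := by
  obtain ⟨h0, rfl⟩ := h
  obtain ⟨a, ha⟩ := Projectivization.exists_smul_eq_mk_rep ℝ x h0
  exact ⟨a, a.ne_zero, ha.symm⟩

theorem HasCoords.inChart_iff {p : RP3} {x : V4} (h : HasCoords p x) (A : V4 ≃ₗ[ℝ] V4) :
    InChart A p ↔ A x 0 ≠ 0 := by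
  obtain ⟨a, ha, hrep⟩ := h.exists_rep
  simp [InChart, hrep, ha]

theorem HasCoords.affCoord_eq {p : RP3} {x : V4} (h : HasCoords p x) (A : V4 ≃ₗ[ℝ] V4) :
    affCoord A p = fun i => A x i.succ / A x 0 := by
  obtain ⟨a, ha, hrep⟩ := h.exists_rep
  ext i
  simp [affCoord, hrep, mul_div_mul_left _ _ ha]

theorem exists_inChart (p : RP3) : ∃ A : V4 ≃ₗ[ℝ] V4, InChart A p := by
  obtain ⟨i, hi⟩ := Function.ne_iff.1 p.rep_nonzero
  exact ⟨LinearEquiv.funCongrLeft ℝ ℝ (Equiv.swap 0 i), by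
    simpa [InChart, LinearEquiv.funCongrLeft_apply, LinearMap.funLeft_apply] using hi⟩

namespace IsLift

variable {γ : ℝ → RP3} {t₀ : ℝ} {X : ℝ → V4} {A : V4 ≃ₗ[ℝ] V4}

theorem chart_ne_zero (hX : IsLift γ t₀ X) (hA : InChart A (γ t₀)) : A (X t₀) 0 ≠ 0 :=
  (hX.2.self_of_nhds.inChart_iff A).1 hA

theorem smoothNear_chart (hX : IsLift γ t₀ X) (i : Fin 4) : SmoothNear (fun t => A (X t) i) t₀ :=
  (hX.1.linear (A : V4 →ₗ[ℝ] V4)).apply i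

theorem affCoord_eventually (hX : IsLift γ t₀ X) :
    ∀ᶠ t in 𝓝 t₀, (affCoord A ∘ γ) t = fun i => A (X t) i.succ / A (X t) 0 := by
  filter_upwards [hX.2] with t ht using ht.affCoord_eq A

theorem smoothNear_affCoord (hX : IsLift γ t₀ X) (hA : InChart A (γ t₀)) :
    SmoothNear (affCoord A ∘ γ) t₀ :=
  SmoothNear.congr (smoothNear_pi fun i => (hX.smoothNear_chart i.succ).div (hX.smoothNear_chart 0)
    (hX.chart_ne_zero hA)) hX.affCoord_eventually

theorem apply_eq_smul (hX : IsLift γ t₀ X) (hA : InChart A (γ t₀)) :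
    ∀ᶠ t in 𝓝 t₀, A (X t) = A (X t) 0 • Matrix.vecCons 1 ((affCoord A ∘ γ) t) := by
  filter_upwards [hX.affCoord_eventually (A := A),
    (hX.smoothNear_chart (A := A) 0).continuousAt.eventually_ne (hX.chart_ne_zero hA)] with t h1 h2
  rw [h1]
  ext i
  refine Fin.cases ?_ (fun i => ?_) i
  · simp
  · simp [mul_div_cancel₀ _ h2]

end IsLift

/-! ### Iterated derivatives and linear maps -/

section Iterated

variable {F G : Type} [NormedAddCommGroup F] [NormedSpace ℝ F] [NormedAddCommGroup G]
  [NormedSpace ℝ G]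

theorem SmoothNear.iteratedDeriv {f : ℝ → F} {t₀ : ℝ} (hf : SmoothNear f t₀) (n : ℕ) :
    SmoothNear (iteratedDeriv n f) t₀ := by
  induction n with
  | zero => simpa using hf
  | succ n ih => rw [iteratedDeriv_succ]; exact ih.deriv

theorem iteratedDeriv_linear [FiniteDimensional ℝ F] {f : ℝ → F} {t₀ : ℝ} (hf : SmoothNear f t₀)
    (L : F →ₗ[ℝ] G) (n : ℕ) :
    ∀ᶠ t in 𝓝 t₀, iteratedDeriv n (fun t => L (f t)) t = L (iteratedDeriv n f t) := by
  induction n with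
  | zero => simp
  | succ n ih =>
    filter_upwards [eventually_eventually_nhds.2 ih, (hf.iteratedDeriv n).eventually] with t h1 h2
    rw [iteratedDeriv_succ, iteratedDeriv_succ, EventuallyEq.deriv_eq h1]
    exact ((LinearMap.toContinuousLinearMap L).hasFDerivAt.comp_hasDerivAt t
      h2.differentiableAt.hasDerivAt).deriv

end Iterated

/-! ### Normal forms of curves of finite type -/

/-- The homogeneous coordinates of the curve of `D`. -/
def DevCurve.homog {t₀ : ℝ} (D : DevCurve t₀) (t : ℝ) : V4 := ![1, D.c₁ t, D.c₂ t, D.c₃ t]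

/-- The linear change `G` of homogeneous coordinates takes the lift `X` to the normal form `D` up
to the factor `x`. -/
structure NormalForm {t₀ : ℝ} (X : ℝ → V4) (G : V4 ≃ₗ[ℝ] V4) (x : ℝ → ℝ) (D : DevCurve t₀)
    (a b d : ℕ) : Prop where
  smooth_x : SmoothNear x t₀
  x_ne_zero : x t₀ ≠ 0
  eq_smul : ∀ᶠ t in 𝓝 t₀, G (X t) = x t • D.homog t
  orders : D.HasOrders a b d
  order_c₁ : HasOrder D.c₁ t₀ (a + 1)
  order_c₂ : HasOrder D.c₂ t₀ (a + b + 2)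
  order_c₃ : HasOrder D.c₃ t₀ (a + b + d + 3)
  order_h₂ : HasOrder D.h₂ t₀ (b + 1)
  order_h₃ : HasOrder D.h₃ t₀ (b + d + 2)
  order_k : HasOrder D.k t₀ (d + 1)

/-- Differentiation lowers a positive order by one and division subtracts orders, so the successive
quotients extend smoothly with known orders. -/
theorem exists_devCurve {c₁ c₂ c₃ : ℝ → ℝ} {t₀ : ℝ} {a b d : ℕ} (h₁ : HasOrder c₁ t₀ (a + 1))
    (h₂ : HasOrder c₂ t₀ (a + b + 2)) (h₃ : HasOrder c₃ t₀ (a + b + d + 3)) :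
    ∃ D : DevCurve t₀, D.c₁ = c₁ ∧ D.c₂ = c₂ ∧ D.c₃ = c₃ ∧ D.HasOrders a b d ∧
      HasOrder D.h₂ t₀ (b + 1) ∧ HasOrder D.h₃ t₀ (b + d + 2) ∧ HasOrder D.k t₀ (d + 1) := by
  obtain ⟨u, hu, eu⟩ := HasOrder.exists_quotient (k := a) (l := b + 1) (g := deriv c₁)
    (HasOrder.deriv (k := a + (b + 1)) h₂) h₁.deriv
  obtain ⟨v, hv, ev⟩ := HasOrder.exists_quotient (k := a) (l := b + d + 2) (g := deriv c₁)
    (HasOrder.deriv (k := a + (b + d + 2))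
      (by rwa [show a + (b + d + 2) + 1 = a + b + d + 3 by omega])) h₁.deriv
  obtain ⟨k, hk, ek⟩ := HasOrder.exists_quotient (k := b) (l := d + 1) (g := deriv u)
    (HasOrder.deriv (k := b + (d + 1)) hv) hu.deriv
  exact ⟨⟨c₁, c₂, c₃, u, v, k, h₁.smoothNear, h₂.smoothNear, h₃.smoothNear, hu.smoothNear,
    hv.smoothNear, hk.smoothNear, eu, ev, ek⟩, rfl, rfl, rfl, ⟨h₁.deriv, hu.deriv, hk.deriv⟩, hu,
      hv, hk⟩

/-- Echelon coordinates for the derivatives at `t₀` are affine coordinates in which the curve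
vanishes to strictly increasing orders. Index `j` of the sequence stands for the derivative of order
`j + 1`. -/
theorem FiniteType.exists_normalForm {γ : ℝ → RP3} {t₀ : ℝ} {X : ℝ → V4} (hγ : FiniteType γ t₀)
    (hX : IsLift γ t₀ X) : ∃ (G : V4 ≃ₗ[ℝ] V4) (x : ℝ → ℝ) (D : DevCurve t₀) (a b d : ℕ),
      NormalForm X G x D a b d := by
  obtain ⟨A, hA⟩ := exists_inChart (γ t₀)
  set c := affCoord A ∘ γ with hc
  have hcs : SmoothNear c t₀ := hX.smoothNear_affCoord hA
  obtain ⟨L, k, hk, hz, hn⟩ := exists_echelon (fun k => iteratedDeriv (k + 1) c t₀)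
    (Submodule.eq_top_of_finrank_eq (by rw [hγ A hA]; simp))
  have hord : ∀ i : Fin 3, HasOrder (fun t => L (c t) i - L (c t₀) i) t₀ (k i + 1) := by
    intro i
    let Li : E3 →ₗ[ℝ] ℝ := (LinearMap.proj i).comp (L : E3 →ₗ[ℝ] E3)
    have hit : ∀ j, iteratedDeriv (j + 1) (fun t => L (c t) i - L (c t₀) i) t₀ =
        L (iteratedDeriv (j + 1) c t₀) i := by
      intro j
      have h1 := (iteratedDeriv_linear hcs Li (j + 1)).self_of_nhds
      have h2 := iteratedDeriv_const_add (𝕜 := ℝ) (n := j + 1) (f := fun t => Li (c t)) (x := t₀)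
        (Nat.succ_pos j) (- Li (c t₀))
      have h3 : (fun t => L (c t) i - L (c t₀) i) = fun t => - Li (c t₀) + Li (c t) := by
        ext t
        show _ = - L (c t₀) i + L (c t) i
        ring
      rw [h3, h2, h1]
      rfl
    refine HasOrder.of_iteratedDeriv ((hcs.linear Li).sub (smoothNear_const _ _)) ?_ ?_
    · rintro (_ | j) hj
      · simp
      · rw [hit]; exact hz i j (by omega)
    · rw [hit]; exact hn i
  obtain ⟨b, hb⟩ := Nat.exists_eq_add_of_lt (hk (show (0 : Fin 3) < 1 by decide))
  obtain ⟨d, hd⟩ := Nat.exists_eq_add_of_lt (hk (show (1 : Fin 3) < 2 by decide))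
  obtain ⟨D, h1, h2, h3, hD, hDh⟩ := exists_devCurve (a := k 0) (b := b) (d := d) (hord 0)
    (by have := hord 1; rwa [hb] at this)
    (by have := hord 2
        rwa [hd, hb, show k 0 + b + 1 + d + 1 + 1 = k 0 + b + d + 3 by omega] at this)
  -- The affine map `y ↦ L y - L (c t₀)` in homogeneous coordinates.
  let M : V4 →ₗ[ℝ] V4 :=
    { toFun := fun y => Matrix.vecCons (y 0) (L (fun i => y i.succ) - y 0 • L (c t₀))
      map_add' := fun y z => by
        have : (fun i : Fin 3 => (y + z) i.succ) = (fun i => y i.succ) + fun i => z i.succ := rfl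
        ext i
        refine Fin.cases ?_ (fun i => ?_) i
        · simp
        · rw [Matrix.cons_val_succ, this, map_add]
          simp only [Matrix.cons_val_succ, Pi.add_apply, Pi.sub_apply, Pi.smul_apply, smul_eq_mul]
          ring
      map_smul' := fun r y => by
        have : (fun i : Fin 3 => (r • y) i.succ) = r • (fun i => y i.succ) := rfl
        ext i
        refine Fin.cases ?_ (fun i => ?_) i
        · simp
        · rw [Matrix.cons_val_succ, this, map_smul]
          simp only [Matrix.cons_val_succ, Pi.sub_apply, Pi.smul_apply, smul_eq_mul,
            RingHom.id_apply]
          ring }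
  have hM : Function.Injective M := by
    refine (injective_iff_map_eq_zero M).2 fun y hy => ?_
    have h0 : y 0 = 0 := congrFun hy 0
    have h4 : L (fun i => y i.succ) = 0 := by
      ext i
      have h5 : (L (fun i => y i.succ) - y 0 • L (c t₀)) i = 0 := congrFun hy i.succ
      simpa [h0] using h5
    have h6 : (fun i : Fin 3 => y i.succ) = 0 := by simpa using h4
    ext i
    refine Fin.cases h0 (fun i => ?_) i
    exact congrFun h6 i
  refine ⟨A.trans (LinearEquiv.ofInjectiveEndo M hM), fun t => A (X t) 0, D, k 0, b, d,
    hX.smoothNear_chart 0, hX.chart_ne_zero hA, ?_, hD, h1 ▸ hord 0, ?_, ?_, hDh.1, hDh.2.1, hDh.2.2⟩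
  · filter_upwards [hX.apply_eq_smul hA] with t ht
    show M (A (X t)) = _
    have h4 : (fun i : Fin 3 => A (X t) i.succ) = A (X t) 0 • c t := by
      ext i
      conv_lhs => rw [ht]
      rfl
    ext i
    refine Fin.cases ?_ (fun i => ?_) i
    · simp [M, DevCurve.homog]
    · simp only [M, LinearMap.coe_mk, AddHom.coe_mk, h4, Matrix.cons_val_succ, map_smul,
        DevCurve.homog, h1, h2, h3, Pi.sub_apply, Pi.smul_apply, smul_eq_mul]
      fin_cases i <;> simp <;> ring
  · rw [h2]; have := hord 1; rwa [hb] at this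
  · rw [h3]; have := hord 2
    rwa [hd, hb, show k 0 + b + 1 + d + 1 + 1 = k 0 + b + d + 3 by omega] at this

/-- In any other chart, the numerators of the projective change to normal form are affine functions
of the curve equal to `c₁, c₂, c₃` times a unit. Units preserve orders, so the linear parts bring
the derivatives in that chart to echelon form with the same pivots. -/
theorem NormalForm.hasType {γ : ℝ → RP3} {t₀ : ℝ} {X : ℝ → V4} {G : V4 ≃ₗ[ℝ] V4} {x : ℝ → ℝ}
    {D : DevCurve t₀} {a b d : ℕ} (hX : IsLift γ t₀ X) (hN : NormalForm X G x D a b d) :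
    HasType γ t₀ (a + 1) (a + b + 2) (a + b + d + 3) := by
  intro B hB
  set c := affCoord B ∘ γ with hc
  have hcs : SmoothNear c t₀ := hX.smoothNear_affCoord hB
  let K : V4 ≃ₗ[ℝ] V4 := B.symm.trans G
  let l : Matrix (Fin 3) (Fin 3) ℝ := Matrix.of fun i j => K (Pi.single j.succ 1) i.succ
  let Li : Fin 3 → E3 →ₗ[ℝ] ℝ := fun i => (LinearMap.proj i).comp (Matrix.mulVecLin l)
  have hK : ∀ (y : E3) (i : Fin 3),
      K (Matrix.vecCons 1 y) i.succ = K (Pi.single 0 1) i.succ + Li i y := by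
    intro y i
    have h1 : (Matrix.vecCons 1 y : V4) = Pi.single 0 1 + ∑ j : Fin 3, y j • Pi.single j.succ 1 := by
      ext m
      refine Fin.cases ?_ (fun m => ?_) m
      · simp [Finset.sum_apply]
      · simp [Finset.sum_apply, Pi.single_apply, Fin.succ_ne_zero]
    rw [h1, map_add, map_sum, Pi.add_apply, Finset.sum_apply]
    congr 1
    simp [Li, l, Matrix.mulVec, dotProduct, mul_comm]
  set C : Fin 3 → ℝ → ℝ := ![D.c₁, D.c₂, D.c₃] with hC
  set k : Fin 3 → ℕ := ![a, a + b + 1, a + b + d + 2] with hk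
  have hCo : ∀ i, HasOrder (C i) t₀ (k i + 1) := by
    intro i
    fin_cases i
    · exact hN.order_c₁
    · exact hN.order_c₂
    · exact hN.order_c₃
  have hord : ∀ i, HasOrder (fun t => K (Pi.single 0 1) i.succ + Li i (c t)) t₀ (k i + 1) := by
    intro i
    have h0 := hX.chart_ne_zero hB
    have hu : HasOrder (fun t => x t / B (X t) 0) t₀ 0 :=
      HasOrder.of_apply_ne_zero (hN.smooth_x.div (hX.smoothNear_chart 0) h0)
        (div_ne_zero hN.x_ne_zero h0)
    have h1 := hu.mul (hCo i)
    rw [zero_add] at h1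
    refine h1.congr ?_
    filter_upwards [hX.apply_eq_smul hB, hN.eq_smul,
      (hX.smoothNear_chart (A := B) 0).continuousAt.eventually_ne h0] with t e1 e2 e3
    rw [← hK]
    have e4 : K (B (X t)) = G (X t) := by simp [K]
    rw [e1, map_smul, e2] at e4
    have e5 : B (X t) 0 * K (Matrix.vecCons 1 (c t)) i.succ = x t * C i t := by
      have := congrFun e4 i.succ
      simp only [Pi.smul_apply, smul_eq_mul] at this
      rw [this]
      fin_cases i <;> rfl
    rw [div_mul_eq_mul_div, ← e5, mul_div_cancel_left₀ _ e3]
  have hit : ∀ i j, iteratedDeriv (j + 1) (fun t => K (Pi.single 0 1) i.succ + Li i (c t)) t₀ =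
      l.mulVec (iteratedDeriv (j + 1) c t₀) i := by
    intro i j
    rw [iteratedDeriv_const_add (Nat.succ_pos j), (iteratedDeriv_linear hcs (Li i) _).self_of_nhds]
    rfl
  have hz : ∀ i, ∀ j < k i, l.mulVec (iteratedDeriv (j + 1) c t₀) i = 0 := fun i j hj => by
    rw [← hit]; exact (hord i).iteratedDeriv_eq_zero (by omega)
  have hn : ∀ i, l.mulVec (iteratedDeriv (k i + 1) c t₀) i ≠ 0 := fun i => by
    rw [← hit]; exact (hord i).iteratedDeriv_ne_zero
  have hmono : StrictMono k := by
    refine Fin.strictMono_iff_lt_succ.2 fun i => ?_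
    fin_cases i
    · show a < a + b + 1
      omega
    · show a + b + 1 < a + b + d + 2
      omega
  have hrank := rank_echelon (fun j => iteratedDeriv (j + 1) c t₀) l k hmono hz hn
  have hle : ∀ r, (derivMatrix c t₀ r).rank ≤ 3 := fun r => by
    simpa using Matrix.rank_le_card_height (derivMatrix c t₀ r)
  have hr0 : ∀ r, (r ≤ a → (derivMatrix c t₀ r).rank ≤ 0) ∧
    (a < r → 0 + 1 ≤ (derivMatrix c t₀ r).rank) := hrank 0
  have hr1 : ∀ r, (r ≤ a + b + 1 → (derivMatrix c t₀ r).rank ≤ 1) ∧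
    (a + b + 1 < r → 1 + 1 ≤ (derivMatrix c t₀ r).rank) := hrank 1
  have hr2 : ∀ r, (r ≤ a + b + d + 2 → (derivMatrix c t₀ r).rank ≤ 2) ∧
    (a + b + d + 2 < r → 2 + 1 ≤ (derivMatrix c t₀ r).rank) := hrank 2
  refine ⟨⟨?_, fun r hr => ?_⟩, ⟨?_, fun r hr => ?_⟩, ⟨?_, fun r hr => ?_⟩⟩
  · exact le_antisymm ((hr1 _).1 (by omega)) ((hr0 _).2 (by omega))
  · by_contra! h
    have h1 := (hr0 r).1 (by omega)
    rw [Set.mem_ofPred_eq] at hr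
    omega
  · exact le_antisymm ((hr2 _).1 (by omega)) ((hr1 _).2 (by omega))
  · by_contra! h
    have h1 := (hr1 r).1 (by omega)
    rw [Set.mem_ofPred_eq] at hr
    omega
  · exact le_antisymm (hle _) ((hr2 _).2 (by omega))
  · by_contra! h
    have h1 := (hr2 r).1 (by omega)
    rw [Set.mem_ofPred_eq] at hr
    omega

/-! ### Projective transformations and reparametrised ruled surfaces -/

/-- The projective transformation of `H` in affine coordinates. -/
def projMap (H : V4 ≃ₗ[ℝ] V4) (y : E3) : E3 := fun i =>
  H (Matrix.vecCons 1 y) i.succ / H (Matrix.vecCons 1 y) 0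

theorem vecCons_projMap {H : V4 ≃ₗ[ℝ] V4} {y : E3} (h : H (Matrix.vecCons 1 y) 0 ≠ 0) :
    Matrix.vecCons 1 (projMap H y) = (H (Matrix.vecCons 1 y) 0)⁻¹ • H (Matrix.vecCons 1 y) := by
  ext i
  refine Fin.cases ?_ (fun i => ?_) i
  · simp [h]
  · simp [projMap, div_eq_inv_mul]

theorem symm_vecCons_projMap {H : V4 ≃ₗ[ℝ] V4} {y : E3} (h : H (Matrix.vecCons 1 y) 0 ≠ 0) :
    H.symm (Matrix.vecCons 1 (projMap H y)) =
      (H (Matrix.vecCons 1 y) 0)⁻¹ • Matrix.vecCons 1 y := by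
  rw [vecCons_projMap h, map_smul, H.symm_apply_apply]

theorem projMap_symm_projMap {H : V4 ≃ₗ[ℝ] V4} {y : E3} (h : H (Matrix.vecCons 1 y) 0 ≠ 0) :
    projMap H.symm (projMap H y) = y := by
  ext i
  rw [projMap, symm_vecCons_projMap h]
  simp only [Pi.smul_apply, Matrix.cons_val_succ, Matrix.cons_val_zero, smul_eq_mul, mul_one]
  field_simp

theorem smoothNear_vecCons_apply (H : V4 ≃ₗ[ℝ] V4) (y : E3) (i : Fin 4) :
    SmoothNear (fun y : E3 => H (Matrix.vecCons 1 y) i) y := by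
  have h1 : SmoothNear (fun y : E3 => (Matrix.vecCons 1 y : V4)) y := smoothNear_pi fun j => by
    refine Fin.cases ?_ (fun j => ?_) j
    · exact smoothNear_const _ _
    · exact (contDiff_apply ℝ ℝ j).smoothNear y
  exact (h1.linear (H : V4 →ₗ[ℝ] V4)).apply i

theorem smoothNear_projMap {H : V4 ≃ₗ[ℝ] V4} {y : E3} (h : H (Matrix.vecCons 1 y) 0 ≠ 0) :
    SmoothNear (projMap H) y :=
  smoothNear_pi fun i => (smoothNear_vecCons_apply H y i.succ).div (smoothNear_vecCons_apply H y 0) h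

theorem diffeoGerm_projMap {H : V4 ≃ₗ[ℝ] V4} {y : E3} (h : H (Matrix.vecCons 1 y) 0 ≠ 0) :
    DiffeoGerm (projMap H) (projMap H.symm) y (projMap H y) := by
  have h' : H.symm (Matrix.vecCons 1 (projMap H y)) 0 ≠ 0 := by
    rw [symm_vecCons_projMap h]; simp [h]
  refine ⟨smoothNear_projMap h, smoothNear_projMap h', rfl, projMap_symm_projMap h, ?_, ?_⟩
  · filter_upwards [(smoothNear_vecCons_apply H y 0).continuousAt.eventually_ne h] with x hx
    exact projMap_symm_projMap hx
  · filter_upwards [(smoothNear_vecCons_apply H.symm _ 0).continuousAt.eventually_ne h'] with x hx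
    exact projMap_symm_projMap (H := H.symm) hx

/-- A fibrewise projective change of the parameter `u`. -/
theorem diffeoGerm_fibrewise {t₀ : ℝ} {r₁ r₂ p q : ℝ → ℝ} (hr₁ : SmoothNear r₁ t₀)
    (hr₂ : SmoothNear r₂ t₀) (hp : SmoothNear p t₀) (hq : SmoothNear q t₀) (hr0 : r₁ t₀ ≠ 0)
    (hp0 : p t₀ = 0) (hq0 : q t₀ ≠ 0) :
    DiffeoGerm (fun z : ℝ × ℝ => (z.1, (p z.1 + z.2 * q z.1) / (r₁ z.1 + z.2 * r₂ z.1)))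
      (fun z => (z.1, (z.2 * r₁ z.1 - p z.1) / (q z.1 - z.2 * r₂ z.1))) (t₀, 0) (t₀, 0) := by
  have l : ∀ {f : ℝ → ℝ}, SmoothNear f t₀ → SmoothNear (fun z : ℝ × ℝ => f z.1) (t₀, 0) :=
    fun hf => SmoothNear.comp_fst (p := (t₀, 0)) hf
  have s1 := (l hr₁).add ((smoothNear_snd (t₀, 0)).mul (l hr₂))
  have s2 := (l hq).sub ((smoothNear_snd (t₀, 0)).mul (l hr₂))
  have s3 := ((l hq).mul (l hr₁)).sub ((l hp).mul (l hr₂))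
  have n1 := s1.continuousAt.eventually_ne (by simpa using hr0)
  have n2 := s2.continuousAt.eventually_ne (by simpa using hq0)
  -- The determinant of the fractional linear change of `u`, equal to `q r₁` at `t₀`.
  have n3 := s3.continuousAt.eventually_ne (y := 0) (by simpa [hp0] using mul_ne_zero hq0 hr0)
  refine ⟨(smoothNear_fst _).prodMk (((l hp).add ((smoothNear_snd _).mul (l hq))).div s1
    (by simpa using hr0)), (smoothNear_fst _).prodMk ((((smoothNear_snd _).mul (l hr₁)).sub
      (l hp)).div s2 (by simpa using hq0)), by simp [hp0], by simp [hp0], ?_, ?_⟩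
  · filter_upwards [n1, n3] with z h1 h3
    refine Prod.ext rfl ?_
    have h4 : q z.1 - (p z.1 + z.2 * q z.1) / (r₁ z.1 + z.2 * r₂ z.1) * r₂ z.1 =
        (q z.1 * r₁ z.1 - p z.1 * r₂ z.1) / (r₁ z.1 + z.2 * r₂ z.1) := by
      field_simp; ring
    simp only [h4]
    field_simp
    ring
  · filter_upwards [n2, n3] with z h2 h3
    refine Prod.ext rfl ?_
    have h4 : r₁ z.1 + (z.2 * r₁ z.1 - p z.1) / (q z.1 - z.2 * r₂ z.1) * r₂ z.1 =
        (q z.1 * r₁ z.1 - p z.1 * r₂ z.1) / (q z.1 - z.2 * r₂ z.1) := by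
      field_simp; ring
    simp only [h4]
    rw [div_eq_iff (div_ne_zero h3 h2)]
    field_simp
    ring

/-- A surface ruled by the tangent lines of `D` is equivalent to the developable of `D`. -/
theorem germEquiv_of_ruled {t₀ : ℝ} {F : ℝ × ℝ → RP3} {R S : ℝ → V4} {A H : V4 ≃ₗ[ℝ] V4}
    (D : DevCurve t₀) {r₁ r₂ p q : ℝ → ℝ}
    (hF : ∀ᶠ z in 𝓝 (t₀, (0 : ℝ)), HasCoords (F z) (R z.1 + z.2 • S z.1))
    (hA : InChart A (F (t₀, 0))) (hr₁ : SmoothNear r₁ t₀)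
    (hr₂ : SmoothNear r₂ t₀) (hp : SmoothNear p t₀) (hq : SmoothNear q t₀) (hr0 : r₁ t₀ ≠ 0)
    (hp0 : p t₀ = 0) (hq0 : q t₀ ≠ 0)
    (hR : ∀ᶠ t in 𝓝 t₀, H (R t) = r₁ t • D.homog t + p t • Matrix.vecCons 0 (D.tangent t))
    (hS : ∀ᶠ t in 𝓝 t₀, H (S t) = r₂ t • D.homog t + q t • Matrix.vecCons 0 (D.tangent t)) :
    GermEquiv D.surface (t₀, 0) (affCoord A ∘ F) (t₀, 0) := by
  have hσ := diffeoGerm_fibrewise hr₁ hr₂ hp hq hr0 hp0 hq0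
  set σ := fun z : ℝ × ℝ => (z.1, (p z.1 + z.2 * q z.1) / (r₁ z.1 + z.2 * r₂ z.1)) with hσdef
  let K : V4 ≃ₗ[ℝ] V4 := H.symm.trans A
  have hfst : Tendsto (Prod.fst : ℝ × ℝ → ℝ) (𝓝 (t₀, (0 : ℝ))) (𝓝 t₀) := continuousAt_fst
  have s1 := (SmoothNear.comp_fst (p := (t₀, (0 : ℝ))) hr₁).add
    ((smoothNear_snd (t₀, 0)).mul (SmoothNear.comp_fst (p := (t₀, (0 : ℝ))) hr₂))
  have n1 := s1.continuousAt.eventually_ne (by simpa using hr0)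
  have main : ∀ᶠ z in 𝓝 (t₀, (0 : ℝ)), A (R z.1 + z.2 • S z.1) =
      (r₁ z.1 + z.2 * r₂ z.1) • K (Matrix.vecCons 1 (D.surface (σ z))) := by
    filter_upwards [hfst.eventually hR, hfst.eventually hS, n1] with z h1 h2 h3
    have h4 : H (R z.1 + z.2 • S z.1) =
        (r₁ z.1 + z.2 * r₂ z.1) • Matrix.vecCons 1 (D.surface (σ z)) := by
      rw [map_add, map_smul, h1, h2]
      ext i
      fin_cases i <;> simp [DevCurve.homog, DevCurve.tangent, DevCurve.surface, hσdef] <;>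
        field_simp <;> ring
    rw [← map_smul, ← h4]
    simp [K]
  have hchart : ∀ᶠ z in 𝓝 (t₀, (0 : ℝ)), (affCoord A ∘ F) z = projMap K (D.surface (σ z)) := by
    filter_upwards [hF, main, n1] with z h1 h2 h3
    rw [Function.comp_apply, h1.affCoord_eq, h2]
    ext i
    simp [projMap, mul_div_mul_left _ _ h3]
  have hσb : σ (t₀, 0) = (t₀, 0) := hσ.map_base
  have hK : K (Matrix.vecCons 1 (D.surface (t₀, 0))) 0 ≠ 0 := by
    have h1 := (hF.self_of_nhds.inChart_iff A).1 hA
    rw [main.self_of_nhds, hσb] at h1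
    exact right_ne_zero_of_mul h1
  have hτ := diffeoGerm_projMap hK
  have hbase : (affCoord A ∘ F) (t₀, 0) = projMap K (D.surface (t₀, 0)) := by
    rw [hchart.self_of_nhds, hσb]
  refine ⟨_, _, _, _, hσ.symm, hbase ▸ hτ, ?_⟩
  filter_upwards [hσ.symm.tendsto.eventually hchart, hσ.right_inv] with z h1 h2
  rw [h1, h2]

/-! ### The tangent developable -/

/-- Where `c₁' ≠ 0` the line through `X` and `W` is the one through `X` and `X'`, that is, through
`homog` and `tangent`. Both sides are continuous, so this persists at `t₀`. -/
theorem NormalForm.frame {γ : ℝ → RP3} {t₀ : ℝ} {X W : ℝ → V4} {G : V4 ≃ₗ[ℝ] V4} {x : ℝ → ℝ}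
    {D : DevCurve t₀} {a b d : ℕ} (hN : NormalForm X G x D a b d) (hW : TangentFrame γ t₀ X W) :
    ∃ w q : ℝ → ℝ, SmoothNear w t₀ ∧ SmoothNear q t₀ ∧ q t₀ ≠ 0 ∧
      ∀ᶠ t in 𝓝 t₀, G (W t) = w t • D.homog t + q t • Matrix.vecCons 0 (D.tangent t) := by
  obtain ⟨hX, hWs, hfr⟩ := hW
  have hGW : ∀ i, SmoothNear (fun t => G (W t) i) t₀ := fun i =>
    (hWs.linear (G : V4 →ₗ[ℝ] V4)).apply i
  have hws : SmoothNear (fun t => G (W t) 0) t₀ := hGW 0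
  have hqs : SmoothNear (fun t => G (W t) 1 - G (W t) 0 * D.c₁ t) t₀ :=
    (hGW 1).sub ((hGW 0).mul D.smooth_c₁)
  have hder : ∀ᶠ t in 𝓝 t₀, G (deriv X t) = deriv x t • D.homog t +
      (x t * deriv D.c₁ t) • Matrix.vecCons 0 (D.tangent t) := by
    filter_upwards [eventually_eventually_nhds.2 hN.eq_smul, hX.1.eventually,
      hN.smooth_x.eventually, D.smooth_c₁.eventually, D.smooth_c₂.eventually,
      D.smooth_c₃.eventually, D.deriv_c₂, D.deriv_c₃] with t h1 h2 hx h3 h4 h5 e2 e3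
    have h6 : HasDerivAt (fun t => G (X t)) (G (deriv X t)) t :=
      (LinearMap.toContinuousLinearMap (G : V4 →ₗ[ℝ] V4)).hasFDerivAt.comp_hasDerivAt t
        h2.differentiableAt.hasDerivAt
    have h7 := h6.congr_of_eventuallyEq (h1.mono fun _ h => h.symm)
    have hx' := hx.differentiableAt.hasDerivAt
    have comp : ∀ {c : ℝ → ℝ}, SmoothNear c t → HasDerivAt (fun t => x t * c t)
        (deriv x t * c t + x t * deriv c t) t := fun hc =>
      hx'.fun_mul hc.differentiableAt.hasDerivAt
    have k1 := (hasDerivAt_pi.1 h7 0).unique (f := fun t => x t * 1) (by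
      exact comp (c := fun _ => 1) (smoothNear_const 1 t))
    have k2 := (hasDerivAt_pi.1 h7 1).unique (comp (c := D.c₁) h3)
    have k3 := (hasDerivAt_pi.1 h7 2).unique (comp (c := D.c₂) h4)
    have k4 := (hasDerivAt_pi.1 h7 3).unique (comp (c := D.c₃) h5)
    rw [e2] at k3
    rw [e3] at k4
    ext i
    fin_cases i
    · simp only [Fin.zero_eta, k1]; simp [DevCurve.homog]
    · simp only [Fin.mk_one, k2]; simp [DevCurve.homog, DevCurve.tangent]
    · show G (deriv X t) 2 = _
      rw [k3]; simp [DevCurve.homog, DevCurve.tangent]; ring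
    · show G (deriv X t) 3 = _
      rw [k4]; simp [DevCurve.homog, DevCurve.tangent]; ring
  have punct : ∀ᶠ t in 𝓝[≠] t₀,
      G (W t) 2 = G (W t) 0 * D.c₂ t + (G (W t) 1 - G (W t) 0 * D.c₁ t) * D.h₂ t ∧
      G (W t) 3 = G (W t) 0 * D.c₃ t + (G (W t) 1 - G (W t) 0 * D.c₁ t) * D.h₃ t := by
    filter_upwards [nhdsWithin_le_nhds (hfr.and (hder.and (hN.eq_smul.and
      (hN.smooth_x.continuousAt.eventually_ne hN.x_ne_zero)))), hN.orders.order_c₁.ne_zero]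
      with t ⟨⟨_, h1⟩, h2, h3, h4⟩ h5
    obtain ⟨α, β, hαβ⟩ := Submodule.mem_span_pair.1 h1
    rw [← hαβ, map_add, map_smul, map_smul, h3] at h2
    have e0 := congrFun h2 0
    have e1 := congrFun h2 1
    have e2 := congrFun h2 2
    have e3 := congrFun h2 3
    simp [DevCurve.homog, DevCurve.tangent] at e0 e1 e2 e3
    -- With `X' = α X + β W`, `β = 0` would make `X'` a multiple of `X`, although `x c₁' ≠ 0`.
    have hβ : β ≠ 0 := by
      rintro rfl
      refine mul_ne_zero h4 h5 ?_
      linear_combination -e1 + D.c₁ t * e0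
    have i2 : G (W t) 2 = G (W t) 0 * D.c₂ t + (G (W t) 1 - G (W t) 0 * D.c₁ t) * D.h₂ t :=
      mul_left_cancel₀ hβ (by
        linear_combination e2 - D.c₂ t * e0 - D.h₂ t * (e1 - D.c₁ t * e0))
    have i3 : G (W t) 3 = G (W t) 0 * D.c₃ t + (G (W t) 1 - G (W t) 0 * D.c₁ t) * D.h₃ t :=
      mul_left_cancel₀ hβ (by
        linear_combination e3 - D.c₃ t * e0 - D.h₃ t * (e1 - D.c₁ t * e0))
    exact ⟨i2, i3⟩
  have all : ∀ᶠ t in 𝓝 t₀, G (W t) = G (W t) 0 • D.homog t +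
      (G (W t) 1 - G (W t) 0 * D.c₁ t) • Matrix.vecCons 0 (D.tangent t) := by
    have i2 := eventually_nhds_of_punctured (hGW 2).continuousAt
      ((hws.mul D.smooth_c₂).add (hqs.mul D.smooth_h₂)).continuousAt
      (punct.mono fun t ht => ht.1)
    have i3 := eventually_nhds_of_punctured (hGW 3).continuousAt
      ((hws.mul D.smooth_c₃).add (hqs.mul D.smooth_h₃)).continuousAt
      (punct.mono fun t ht => ht.2)
    filter_upwards [i2, i3] with t h2 h3
    ext i
    fin_cases i
    · simp [DevCurve.homog]
    · simp [DevCurve.homog, DevCurve.tangent]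
    · simpa [DevCurve.homog, DevCurve.tangent] using h2
    · simpa [DevCurve.homog, DevCurve.tangent] using h3
  refine ⟨_, _, hws, hqs, fun h0 => ?_, all⟩
  have h1 := all.self_of_nhds
  rw [h0, zero_smul, add_zero] at h1
  generalize G (W t₀) 0 = w at h1
  have h2 : w • X t₀ + (- x t₀) • W t₀ = 0 := by
    apply G.injective
    rw [map_add, map_smul, map_smul, hN.eq_smul.self_of_nhds, map_zero, smul_smul, h1]
    module
  have h3 := LinearIndependent.pair_iff.1 hfr.self_of_nhds.1 _ _ h2
  exact hN.x_ne_zero (neg_eq_zero.1 h3.2)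

theorem germEquiv_of_isTangentDevelopable {γ : ℝ → RP3} {t₀ : ℝ} {F : ℝ × ℝ → RP3}
    (hγ : FiniteType γ t₀) (hF : IsTangentDevelopable γ t₀ F) :
    ∃ (D : DevCurve t₀) (a b d : ℕ), D.HasOrders a b d ∧
      HasType γ t₀ (a + 1) (a + b + 2) (a + b + d + 3) ∧
      ∀ A, InChart A (F (t₀, 0)) → GermEquiv D.surface (t₀, 0) (affCoord A ∘ F) (t₀, 0) := by
  obtain ⟨X, W, hfr, hF⟩ := hF
  obtain ⟨G, x, D, a, b, d, hN⟩ := hγ.exists_normalForm hfr.1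
  obtain ⟨w, q, hw, hq, hq0, hGW⟩ := hN.frame hfr
  refine ⟨D, a, b, d, hN.orders, hN.hasType hfr.1, fun A hA => ?_⟩
  exact germEquiv_of_ruled (H := G) D hF hA hN.smooth_x hw (smoothNear_const 0 t₀) hq hN.x_ne_zero
    rfl hq0 (hN.eq_smul.mono fun t ht => by rw [ht, zero_smul, add_zero]) hGW

/-! ### Duality -/

/-- The dual curve of osculating planes, in normal form. -/
def DevCurve.dual {t₀ : ℝ} (D : DevCurve t₀) : DevCurve t₀ where
  -- The osculating plane has dual coordinates `(e, k h₂ - h₃, -k, 1)`, where `e` makes it pass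
  -- through the curve point and is the `c₃` below. Reversing them, with a sign on `-k`, gives `(1,
  -- c₁, c₂, c₃)` of the dual curve.
  c₁ := D.k
  c₂ := fun t => D.k t * D.h₂ t - D.h₃ t
  c₃ := fun t => -(D.c₃ t - D.k t * D.c₂ t + (D.k t * D.h₂ t - D.h₃ t) * D.c₁ t)
  h₂ := D.h₂
  h₃ := fun t => D.c₂ t - D.h₂ t * D.c₁ t
  k := fun t => - D.c₁ t
  smooth_c₁ := D.smooth_k
  smooth_c₂ := (D.smooth_k.mul D.smooth_h₂).sub D.smooth_h₃
  smooth_c₃ := ((D.smooth_c₃.sub (D.smooth_k.mul D.smooth_c₂)).add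
    (((D.smooth_k.mul D.smooth_h₂).sub D.smooth_h₃).mul D.smooth_c₁)).neg
  smooth_h₂ := D.smooth_h₂
  smooth_h₃ := D.smooth_c₂.sub (D.smooth_h₂.mul D.smooth_c₁)
  smooth_k := D.smooth_c₁.neg
  deriv_c₂ := by
    filter_upwards [D.smooth_k.eventually, D.smooth_h₂.eventually, D.smooth_h₃.eventually,
      D.deriv_h₃] with t h1 h2 h3 e
    rw [((h1.differentiableAt.hasDerivAt.fun_mul h2.differentiableAt.hasDerivAt).fun_sub
      h3.differentiableAt.hasDerivAt).deriv, e]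
    ring
  deriv_c₃ := by
    filter_upwards [D.smooth_k.eventually, D.smooth_h₂.eventually, D.smooth_h₃.eventually,
      D.smooth_c₁.eventually, D.smooth_c₂.eventually, D.smooth_c₃.eventually,
      D.deriv_h₃, D.deriv_c₂, D.deriv_c₃] with t h1 h2 h3 h4 h5 h6 e1 e2 e3
    have k1 := h1.differentiableAt.hasDerivAt
    rw [((h6.differentiableAt.hasDerivAt.fun_sub (k1.fun_mul h5.differentiableAt.hasDerivAt)).fun_add
      (((k1.fun_mul h2.differentiableAt.hasDerivAt).fun_sub
        h3.differentiableAt.hasDerivAt).fun_mul h4.differentiableAt.hasDerivAt)).fun_neg.deriv,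
      e1, e2, e3]
    ring
  deriv_h₃ := by
    filter_upwards [D.smooth_h₂.eventually, D.smooth_c₁.eventually, D.smooth_c₂.eventually,
      D.deriv_c₂] with t h1 h2 h3 e
    rw [(h3.differentiableAt.hasDerivAt.fun_sub
      (h1.differentiableAt.hasDerivAt.fun_mul h2.differentiableAt.hasDerivAt)).deriv, e]
    ring

/-- Duality exchanges `c₁` and `k` up to sign and fixes `h₂`. -/
theorem DevCurve.HasOrders.dual {t₀ : ℝ} {D : DevCurve t₀} {a b d : ℕ} (h : D.HasOrders a b d) :
    D.dual.HasOrders d b a :=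
  ⟨h.order_k, h.order_h₂, h.order_c₁.neg.congr (Eventually.of_forall fun t => by
    simp [DevCurve.dual])⟩

theorem exists_contragredient (G : V4 ≃ₗ[ℝ] V4) :
    ∃ H : V4 ≃ₗ[ℝ] V4, ∀ v y : V4, G v ⬝ᵥ H y = v ⬝ᵥ y := by
  let M : Matrix (Fin 4) (Fin 4) ℝ := LinearMap.toMatrix' (G.symm : V4 →ₗ[ℝ] V4)
  have key : ∀ v y : V4, G v ⬝ᵥ M.transpose.mulVecLin y = v ⬝ᵥ y := by
    intro v y
    rw [Matrix.mulVecLin_apply, Matrix.dotProduct_mulVec, Matrix.vecMul_transpose,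
      LinearMap.toMatrix'_mulVec]
    simp
  have hinj : Function.Injective M.transpose.mulVecLin := by
    refine (injective_iff_map_eq_zero _).2 fun y hy => ?_
    have := key y y
    rw [hy, dotProduct_zero] at this
    exact dotProduct_self_eq_zero.1 this.symm
  exact ⟨LinearEquiv.ofInjectiveEndo _ hinj, key⟩

/-- Reversal of the dual coordinates, with the sign that puts the dual curve in normal form. -/
theorem exists_reversal : ∃ S : V4 ≃ₗ[ℝ] V4, ∀ y : V4, S y = ![y 3, - y 2, y 1, y 0] := by
  let M : V4 →ₗ[ℝ] V4 :=
    { toFun := fun y => ![y 3, - y 2, y 1, y 0]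
      map_add' := fun y z => by
        ext i; fin_cases i <;> simp
        ring
      map_smul' := fun r y => by ext i; fin_cases i <;> simp }
  have hinj : Function.Injective M := by
    refine (injective_iff_map_eq_zero _).2 fun y hy => ?_
    have e0 : y 3 = 0 := congrFun hy 0
    have e1 : - y 2 = 0 := congrFun hy 1
    have e2 : y 1 = 0 := congrFun hy 2
    have e3 : y 0 = 0 := congrFun hy 3
    ext i
    fin_cases i
    · exact e3
    · exact e2
    · exact neg_eq_zero.1 e1
    · exact e0
  exact ⟨LinearEquiv.ofInjectiveEndo M hinj, fun y => rfl⟩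

/-- In normal form the osculating plane has vanishing third dual coordinate. -/
theorem NormalForm.osculating {t₀ : ℝ} {X : ℝ → V4} {G : V4 ≃ₗ[ℝ] V4} {x : ℝ → ℝ}
    {D : DevCurve t₀} {a b d : ℕ} (hN : NormalForm X G x D a b d) (hX : SmoothNear X t₀) {y η : V4}
    (hy : IsOsculatingPlane X t₀ y) (hη : ∀ v, G v ⬝ᵥ η = v ⬝ᵥ y) (h0 : η 0 = 0) (h1 : η 1 = 0) :
    η 2 = 0 := by
  obtain ⟨hy0, k, hfin, hk⟩ := hy
  by_contra h2
  have hu : HasOrder x t₀ 0 := HasOrder.of_apply_ne_zero hN.smooth_x hN.x_ne_zero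
  have coord : ∀ (i : Fin 4) {c : ℝ → ℝ} {m : ℕ}, (∀ t, D.homog t i = c t) → HasOrder c t₀ m →
      HasOrder (fun t => G (X t) i) t₀ m := by
    intro i c m hc hm
    have := hu.mul hm
    rw [zero_add] at this
    refine this.congr ?_
    filter_upwards [hN.eq_smul] with t ht
    rw [ht, Pi.smul_apply, hc, smul_eq_mul]
  have o2 := coord 2 (c := D.c₂) (fun _ => rfl) hN.order_c₂
  have o3 := coord 3 (c := D.c₃) (fun _ => rfl) hN.order_c₃
  -- If `η 2 ≠ 0`, the term in `c₂` dominates that in `c₃`. The plane then annihilates no derivative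
  -- of order `a + b + 2`, so `k < a + b + 2`.
  have osum : HasOrder (fun t => G (X t) ⬝ᵥ η) t₀ (a + b + 2) := by
    obtain ⟨f, hf, hf0, ef⟩ := o2
    obtain ⟨g, hg, hg0, eg⟩ := o3
    refine ⟨fun t => f t * η 2 + (t - t₀) ^ (d + 1) * g t * η 3,
      (hf.mul (smoothNear_const _ _)).add (((smoothNear_sub_pow t₀ t₀ _).mul hg).mul
        (smoothNear_const _ _)), ?_, ?_⟩
    · simpa using ⟨hf0, h2⟩
    · filter_upwards [ef, eg] with t e2 e3
      simp only [dotProduct, Fin.sum_univ_four, h0, h1, e2, e3]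
      ring
  have hlt : k < a + b + 2 := by
    by_contra! hle
    refine osum.iteratedDeriv_ne_zero ?_
    let L : V4 →ₗ[ℝ] ℝ := LinearMap.mk ⟨fun v => v ⬝ᵥ y, fun v w => add_dotProduct v w y⟩
      (fun r v => smul_dotProduct r v y)
    have h3 := (iteratedDeriv_linear hX L (a + b + 2)).self_of_nhds
    have h4 : (fun t => G (X t) ⬝ᵥ η) = fun t => L (X t) := funext fun t => hη (X t)
    rw [h4, h3]
    exact hk _ hle
  have hcoord : ∀ (i : Fin 4) {m : ℕ}, HasOrder (fun t => G (X t) i) t₀ m → ∀ j < m,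
      G (iteratedDeriv j X t₀) i = 0 := by
    intro i m hm j hj
    have h3 := (iteratedDeriv_linear hX ((LinearMap.proj i).comp (G : V4 →ₗ[ℝ] V4)) j).self_of_nhds
    exact h3.symm.trans (hm.iteratedDeriv_eq_zero hj)
  -- Below order `a + b + 2` coordinates 2 and 3 of every derivative vanish, so the span has
  -- dimension at most 2, not 3.
  have hle : Submodule.span ℝ (Set.range fun j : Fin (k + 1) => iteratedDeriv (j : ℕ) X t₀) ≤
      Submodule.span ℝ (({G.symm (Pi.single 0 1), G.symm (Pi.single 1 1)} : Finset V4) : Set V4) := by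
    refine Submodule.span_le.2 ?_
    rintro _ ⟨j, rfl⟩
    have hj : (j : ℕ) < a + b + 2 := by have := j.2; omega
    have j2 := hcoord 2 o2 j hj
    have j3 := hcoord 3 o3 j (by omega)
    rw [Finset.coe_insert, Finset.coe_singleton]
    refine Submodule.mem_span_pair.2 ⟨G (iteratedDeriv j X t₀) 0, G (iteratedDeriv j X t₀) 1, ?_⟩
    apply G.injective
    simp only [map_add, map_smul, LinearEquiv.apply_symm_apply]
    ext i
    fin_cases i
    · simp
    · simp
    · simpa using j2.symm
    · simpa using j3.symm
  have h5 := Submodule.finrank_mono hle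
  have h6 := finrank_span_finset_le_card (R := ℝ)
    ({G.symm (Pi.single 0 1), G.symm (Pi.single 1 1)} : Finset V4)
  have h7 : ({G.symm (Pi.single 0 1), G.symm (Pi.single 1 1)} : Finset V4).card ≤ 2 :=
    Finset.card_le_two
  rw [Set.finrank] at h6
  omega

/-- The pencil of planes through the tangent line at `t` is, in the dual space, the tangent line of
the dual curve at `t`. The osculating condition places the base point of the germ on the dual curve.
-/
theorem germEquiv_of_isDualSurface {γ : ℝ → RP3} {t₀ : ℝ} {F : ℝ × ℝ → RP3}
    (hγ : FiniteType γ t₀) (hF : IsDualSurface γ t₀ F) :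
    ∃ (D : DevCurve t₀) (a b d : ℕ), D.HasOrders d b a ∧
      HasType γ t₀ (a + 1) (a + b + 2) (a + b + d + 3) ∧
      ∀ A, InChart A (F (t₀, 0)) → GermEquiv D.surface (t₀, 0) (affCoord A ∘ F) (t₀, 0) := by
  obtain ⟨X, W, Y, Z, hfr, hY, hZ, hYZ, hosc, hF⟩ := hF
  obtain ⟨G, x, D, a, b, d, hN⟩ := hγ.exists_normalForm hfr.1
  obtain ⟨w, q, hw, hq, hq0, hGW⟩ := hN.frame hfr
  obtain ⟨H, hH⟩ := exists_contragredient G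
  obtain ⟨S, hS⟩ := exists_reversal
  refine ⟨D.dual, a, b, d, hN.orders.dual, hN.hasType hfr.1, fun A hA => ?_⟩
  have orth : ∀ {P : ℝ → V4}, (∀ᶠ t in 𝓝 t₀, X t ⬝ᵥ P t = 0 ∧ W t ⬝ᵥ P t = 0) →
      ∀ᶠ t in 𝓝 t₀, H (P t) 0 + D.c₁ t * H (P t) 1 + D.c₂ t * H (P t) 2 + D.c₃ t * H (P t) 3 = 0 ∧
        H (P t) 1 + D.h₂ t * H (P t) 2 + D.h₃ t * H (P t) 3 = 0 := by
    intro P hP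
    filter_upwards [hP, hN.eq_smul, hGW, hq.continuousAt.eventually_ne hq0,
      hN.smooth_x.continuousAt.eventually_ne hN.x_ne_zero] with t ⟨h1, h2⟩ e1 e2 hqt hxt
    rw [← hH, e1] at h1
    rw [← hH, e2] at h2
    simp only [DevCurve.homog, DevCurve.tangent, dotProduct, Fin.sum_univ_four, Pi.add_apply,
      Pi.smul_apply, smul_eq_mul, Matrix.cons_val] at h1 h2
    have h3 : H (P t) 0 + D.c₁ t * H (P t) 1 + D.c₂ t * H (P t) 2 + D.c₃ t * H (P t) 3 = 0 :=
      (mul_eq_zero.1 (show x t * _ = 0 by linear_combination h1)).resolve_left hxt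
    refine ⟨h3, (mul_eq_zero.1 (show q t * _ = 0 from ?_)).resolve_left hqt⟩
    linear_combination h2 - w t * h3
  -- The two incidence relations determine dual coordinates 0 and 1 from 2 and 3, which are the two
  -- coefficients up to a triangular change.
  have decomp : ∀ {P : ℝ → V4}, (∀ᶠ t in 𝓝 t₀, X t ⬝ᵥ P t = 0 ∧ W t ⬝ᵥ P t = 0) →
      ∀ᶠ t in 𝓝 t₀, (H.trans S) (P t) = H (P t) 3 • D.dual.homog t +
        (- H (P t) 2 - H (P t) 3 * D.k t) • Matrix.vecCons 0 (D.dual.tangent t) := by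
    intro P hP
    filter_upwards [orth hP] with t ⟨h1, h2⟩
    rw [LinearEquiv.trans_apply, hS]
    ext i
    fin_cases i
    · simp [DevCurve.homog, DevCurve.dual]
    · simp [DevCurve.homog, DevCurve.dual, DevCurve.tangent]
    · simp [DevCurve.homog, DevCurve.dual, DevCurve.tangent]
      linear_combination h2
    · simp [DevCurve.homog, DevCurve.dual, DevCurve.tangent]
      linear_combination h1 - D.c₁ t * h2
  have hYo : ∀ᶠ t in 𝓝 t₀, X t ⬝ᵥ Y t = 0 ∧ W t ⬝ᵥ Y t = 0 :=
    hYZ.mono fun t h => ⟨h.2.1, h.2.2.1⟩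
  have hZo : ∀ᶠ t in 𝓝 t₀, X t ⬝ᵥ Z t = 0 ∧ W t ⬝ᵥ Z t = 0 :=
    hYZ.mono fun t h => ⟨h.2.2.2.1, h.2.2.2.2⟩
  have comp : ∀ {P : ℝ → V4}, SmoothNear P t₀ → ∀ i, SmoothNear (fun t => H (P t) i) t₀ :=
    fun hP i => (hP.linear (H : V4 →ₗ[ℝ] V4)).apply i
  have hk0 : D.k t₀ = 0 := hN.order_k.apply_eq_zero (by omega)
  -- In normal form incidence at `t₀` kills dual coordinates 0 and 1 of `Y t₀`, and osculation kills
  -- coordinate 2; with `k t₀ = 0` the tangent coefficient of `Y` vanishes at `t₀`.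
  have hy2 : H (Y t₀) 2 = 0 := by
    obtain ⟨e0, e1⟩ := (orth hYo).self_of_nhds
    rw [hN.order_c₁.apply_eq_zero (by omega), hN.order_c₂.apply_eq_zero (by omega),
      hN.order_c₃.apply_eq_zero (by omega)] at e0
    rw [hN.order_h₂.apply_eq_zero (by omega), hN.order_h₃.apply_eq_zero (by omega)] at e1
    exact hN.osculating hfr.1.1 hosc (fun v => hH v (Y t₀)) (by linear_combination e0)
      (by linear_combination e1)
  have hy3 : H (Y t₀) 3 ≠ 0 := by
    intro h3
    have h1 := (decomp hYo).self_of_nhds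
    rw [h3, hy2] at h1
    simp only [zero_smul, neg_zero, zero_mul, sub_zero, add_zero] at h1
    exact hosc.1 ((LinearEquiv.map_eq_zero_iff _).1 h1)
  refine germEquiv_of_ruled (H := H.trans S) D.dual hF hA (comp hY 3) (comp hZ 3)
    ((comp hY 2).neg.sub ((comp hY 3).mul D.smooth_k))
    ((comp hZ 2).neg.sub ((comp hZ 3).mul D.smooth_k)) hy3 (by rw [hy2, hk0]; ring) ?_
    (decomp hYo) (decomp hZo)
  -- Otherwise `Y t₀` and `Z t₀` would both be multiples of the dual curve point.
  intro hq'
  have h1 := (decomp hYo).self_of_nhds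
  have h2 := (decomp hZo).self_of_nhds
  rw [hq', zero_smul, add_zero] at h2
  rw [hy2, hk0] at h1
  simp only [neg_zero, mul_zero, sub_zero, zero_smul, add_zero] at h1
  have h3 : H (Z t₀) 3 • Y t₀ + (- H (Y t₀) 3) • Z t₀ = 0 := by
    apply (H.trans S).injective
    rw [map_add, map_smul, map_smul, h1, h2, map_zero]
    module
  exact hy3 (neg_eq_zero.1 (LinearIndependent.pair_iff.1 hYZ.self_of_nhds.1 _ _ h3).2)

/-! ### The models -/

/-- The curve whose developable is the model cuspidal edge. -/
def edgeCurve : DevCurve 0 where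
  -- For fixed `t` the model is a line in `x` with direction `(1, -2t, -t²)`, and its `t`-derivative
  -- vanishes at `x = 3t`.
  c₁ := fun t => 3 * t
  c₂ := fun t => -3 * t ^ 2
  c₃ := fun t => -t ^ 3
  h₂ := fun t => -2 * t
  h₃ := fun t => -t ^ 2
  k := fun t => t
  smooth_c₁ := ContDiff.smoothNear (by fun_prop) 0
  smooth_c₂ := ContDiff.smoothNear (by fun_prop) 0
  smooth_c₃ := ContDiff.smoothNear (by fun_prop) 0
  smooth_h₂ := ContDiff.smoothNear (by fun_prop) 0
  smooth_h₃ := ContDiff.smoothNear (by fun_prop) 0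
  smooth_k := ContDiff.smoothNear (by fun_prop) 0
  deriv_c₂ := Eventually.of_forall fun t => by simp; ring
  deriv_c₃ := Eventually.of_forall fun t => by simp; ring
  deriv_h₃ := Eventually.of_forall fun t => by simp; ring

/-- The curve whose developable is the model swallowtail. -/
def tailCurve : DevCurve 0 where
  -- The rulings have the same directions as for the cuspidal edge; the `t`-derivative of the model
  -- vanishes at `x = 6t²`.
  c₁ := fun t => 6 * t ^ 2
  c₂ := fun t => -8 * t ^ 3
  c₃ := fun t => -3 * t ^ 4
  h₂ := fun t => -2 * t
  h₃ := fun t => -t ^ 2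
  k := fun t => t
  smooth_c₁ := ContDiff.smoothNear (by fun_prop) 0
  smooth_c₂ := ContDiff.smoothNear (by fun_prop) 0
  smooth_c₃ := ContDiff.smoothNear (by fun_prop) 0
  smooth_h₂ := ContDiff.smoothNear (by fun_prop) 0
  smooth_h₃ := ContDiff.smoothNear (by fun_prop) 0
  smooth_k := ContDiff.smoothNear (by fun_prop) 0
  deriv_c₂ := Eventually.of_forall fun t => by simp; ring
  deriv_c₃ := Eventually.of_forall fun t => by simp; ring
  deriv_h₃ := Eventually.of_forall fun t => by simp; ring

theorem edgeCurve_hasOrders : edgeCurve.HasOrders 0 0 0 := by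
  refine ⟨⟨fun _ => 3, smoothNear_const _ _, by norm_num, ?_⟩,
    ⟨fun _ => -2, smoothNear_const _ _, by norm_num, ?_⟩,
    ⟨fun _ => 1, smoothNear_const _ _, by norm_num, ?_⟩⟩ <;>
  exact Eventually.of_forall fun t => by simp [edgeCurve]

theorem tailCurve_hasOrders : tailCurve.HasOrders 1 0 0 := by
  refine ⟨⟨fun _ => 12, smoothNear_const _ _, by norm_num, ?_⟩,
    ⟨fun _ => -2, smoothNear_const _ _, by norm_num, ?_⟩,
    ⟨fun _ => 1, smoothNear_const _ _, by norm_num, ?_⟩⟩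
  · exact Eventually.of_forall fun t => by simp [tailCurve]; ring
  · exact Eventually.of_forall fun t => by simp [tailCurve]
  · exact Eventually.of_forall fun t => by simp [tailCurve]

theorem germEquiv_of_eq_surface (D : DevCurve 0) {f : ℝ × ℝ → E3} (h0 : D.c₁ 0 = 0)
    (hc : ContDiff ℝ ∞ D.c₁) (hf : ∀ t u, D.surface (t, u) = f (D.c₁ t + u, t)) :
    GermEquiv D.surface (0, 0) f (0, 0) := by
  have hb : D.surface (0, 0) = f (0, 0) := by rw [hf, h0, zero_add]
  have hc' : ContDiff ℝ ∞ fun z : ℝ × ℝ => D.c₁ z.1 := hc.comp contDiff_fst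
  have hc'' : ContDiff ℝ ∞ fun z : ℝ × ℝ => D.c₁ z.2 := hc.comp contDiff_snd
  refine ⟨fun z => (D.c₁ z.1 + z.2, z.1), fun z => (z.2, z.1 - D.c₁ z.2), id, id,
    ⟨ContDiff.smoothNear (by fun_prop) _, ContDiff.smoothNear (by fun_prop) _, by simp [h0],
      by simp [h0], Eventually.of_forall fun z => by simp, Eventually.of_forall fun z => by simp⟩,
    hb ▸ ⟨contDiff_id.smoothNear _, contDiff_id.smoothNear _, rfl, rfl,
      Eventually.of_forall fun _ => rfl, Eventually.of_forall fun _ => rfl⟩,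
    Eventually.of_forall fun z => hf z.1 z.2⟩

theorem germEquiv_cuspidalEdge : GermEquiv edgeCurve.surface (0, 0) cuspidalEdge (0, 0) :=
  germEquiv_of_eq_surface _ (by simp [edgeCurve]) (by simp only [edgeCurve]; fun_prop) fun t u => by
    ext i
    fin_cases i <;> simp [edgeCurve, DevCurve.surface, cuspidalEdge] <;> ring

theorem germEquiv_swallowtail : GermEquiv tailCurve.surface (0, 0) swallowtail (0, 0) :=
  germEquiv_of_eq_surface _ (by simp [tailCurve]) (by simp only [tailCurve]; fun_prop) fun t u => by
    ext i
    fin_cases i <;> simp [tailCurve, DevCurve.surface, swallowtail] <;> ring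

end TangentDev

end


theorem mainTheorem9 :
    (∀ (γ γ' : ℝ → TangentDev.RP3) (t₀ t₀' : ℝ) (F F' : ℝ × ℝ → TangentDev.RP3),
      TangentDev.SmoothCurveGerm γ t₀ → TangentDev.SmoothCurveGerm γ' t₀' →
      TangentDev.FiniteType γ t₀ → TangentDev.FiniteType γ' t₀' →
      TangentDev.IsTangentDevelopable γ t₀ F → TangentDev.IsTangentDevelopable γ' t₀' F' →
      TangentDev.DiffeoGerms F (t₀, 0) F' (t₀', 0) →
      ∃ a₁ a₂ a₃ : ℕ, TangentDev.HasType γ t₀ a₁ a₂ a₃ ∧ TangentDev.HasType γ' t₀' a₁ a₂ a₃) ∧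
    (∀ (γ : ℝ → TangentDev.RP3) (t₀ : ℝ) (F : ℝ × ℝ → TangentDev.RP3),
      TangentDev.SmoothCurveGerm γ t₀ → TangentDev.FiniteType γ t₀ →
      TangentDev.IsDualSurface γ t₀ F →
      (TangentDev.DiffeoToModel F (t₀, 0) TangentDev.cuspidalEdge →
        TangentDev.HasType γ t₀ 1 2 3) ∧
      (TangentDev.DiffeoToModel F (t₀, 0) TangentDev.swallowtail →
        TangentDev.HasType γ t₀ 1 2 4)) := by
  refine ⟨fun γ γ' t₀ t₀' F F' _ _ hγ hγ' hF hF' ⟨A, B, hA, hB, he⟩ => ?_,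
    fun γ t₀ F _ hγ hF => ?_⟩
  · obtain ⟨D, a, b, d, hD, hT, hE⟩ := TangentDev.germEquiv_of_isTangentDevelopable hγ hF
    obtain ⟨D', a', b', d', hD', hT', hE'⟩ := TangentDev.germEquiv_of_isTangentDevelopable hγ' hF'
    have h := (hE A hA).trans (he.germEquiv.trans
      ((hE' B hB).symm D'.smoothNear_surface.continuousAt))
    obtain ⟨rfl, rfl, rfl⟩ := D.orders_unique D' hD hD' h
    exact ⟨_, _, _, hT, hT'⟩
  · obtain ⟨D, a, b, d, hD, hT, hE⟩ := TangentDev.germEquiv_of_isDualSurface hγ hF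
    constructor
    · rintro ⟨A, hA, he⟩
      obtain ⟨rfl, rfl, rfl⟩ := D.orders_unique _ hD TangentDev.edgeCurve_hasOrders
        ((hE A hA).trans (he.germEquiv.trans (TangentDev.germEquiv_cuspidalEdge.symm
          TangentDev.edgeCurve.smoothNear_surface.continuousAt)))
      exact hT
    · rintro ⟨A, hA, he⟩
      -- The dual curve has orders `(d, b, a) = (1, 0, 0)`, so the 1 falls on `d` and raises only
      -- the last entry of the type of `γ`.
      obtain ⟨rfl, rfl, rfl⟩ := D.orders_unique _ hD TangentDev.tailCurve_hasOrders
        ((hE A hA).trans (he.germEquiv.trans (TangentDev.germEquiv_swallowtail.symm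
          TangentDev.tailCurve.smoothNear_surface.continuousAt)))
      exact hT
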